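/- Let $Q$ be a finite set. A \emph{transition counter system} $\mathcal C$ with set of user states $Q$ (and no controller) is given by a set $\mathcal D\subseteq\mathbb N^{Q\times Q}$ of multisets of transitions $p\to q$. For $D\in\mathcal D$ put $\mathrm{pre}(D)(p)=\sum_q D(p,q)$ and $\mathrm{post}(D)(q)=\sum_p D(p,q)$. Configurations are vectors $v\in\mathbb N^Q$, and there is a step $v\to v'$ if some $D\in\mathcal D$ satisfies $\mathrm{pre}(D)\le v$ and $v'=v-\mathrm{pre}(D)+\mathrm{post}(D)$. Write $\mathrm{supp}(v)=\{q: v(q)\ge 1\}$, and $v\preceq_0 w$ if $v\le w$ componentwise and $\mathrm{supp}(v)=\mathrm{supp}(w)$. The system is \emph{$\preceq_0$-compatible} if (forward) whenever $v\to v'$ and $v\preceq_0 w$ there is a step $w\to w'$ with $v'\preceq_0 w'$, and (backward) whenever $v\to v'$ and $v'\preceq_0 w'$ there is a step $w\to w'$ with $v\preceq_0 w$. Let $\mathcal D_{\min}$ be the (finite) set of those $D\in\mathcal D$ for which no $D'\in\mathcal D$ with $D'\ne D$ satisfies $D'\le D$ componentwise and $\{t: D'(t)\ge1\}=\{t: D(t)\ge1\}$.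 Given $Q_0\subseteq Q$, a configuration is \emph{initial} if it vanishes outside $Q_0$. The 01-counter system $\mathcal C_\alpha$ has configurations $\{0,1\}^Q$ and a step $\alpha(v)\to\alpha(v')$ for each step $v\to v'$ of $\mathcal C$, where $\alpha(v)$ is the indicator vector of $\mathrm{supp}(v)$; again a configuration is initial if it vanishes outside $Q_0$. A constraint $\varphi\in CC[\ge a,=0]$ is built from atoms $\#q\ge a$ ($a\in\mathbb N$) and $\#q=0$ by $\wedge$ and $\vee$; $\varphi_\alpha$ is obtained by replacing each atom $\#q\ge a$ with $a\ge1$ by $\#q\ge 1$. The cardinality reachability problem (CRP) asks, given $\mathcal C$, $Q_0$ and $\varphi$, whether a configuration satisfying $\varphi$ is reachable in $\mathcal C$ from an initial configuration. \textbf{Theorem.} (1) The CRP for $\preceq_0$-compatible transition counter systems $\mathcal C$ and $\varphi\in CC[\ge a,=0]$ is in NP. Here an instance is encoded by $|Q|$ in unary, the characteristic vector of $Q_0$, the list of the elements of $\mathcal D_{\min}$ (as matrices with entries in binary), and $\varphi$ (with the constants $a$ in binary). (2) Let $\mathcal C$ be a $\preceq_0$-compatible transition counter system and $Q_0\subseteq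 Q$. Call a run (a path starting in an initial configuration) \emph{normalized} if it consists of a prefix, each step of which strictly enlarges the support, followed by a suffix, each step of which strictly shrinks the support, with at most $2|Q|$ steps in total. Then: (a) for every run of $\mathcal C_\alpha$ there is a normalized run of $\mathcal C_\alpha$ with the same first and the same last configuration; (b) for every $\varphi\in CC[\ge a,=0]$, a configuration satisfying $\varphi$ is reachable in $\mathcal C$ if and only if $\mathcal C_\alpha$ has a normalized run that ends in a configuration satisfying $\varphi_\alpha$; (c) in that case, $\mathcal C$ itself has a normalized run that ends in a configuration satisfying $\varphi$. -/

import Mathlib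

open Computability Turing

/-! ### Counter systems -/

/-- A configuration: the state of the controller, and the number of user processes in each
user state. -/
abbrev Config (C Q : Type*) := C × (Q → ℕ)

/-- A configuration of the 01-abstraction, an element of `C × {0,1}^Q`. -/
abbrev AbsConfig (C Q : Type*) := C × (Q → Bool)

/-- A counter system with controller states `C` and user states `Q`: a size-preserving step
relation on configurations. -/
structure CounterSystem (C Q : Type*) [Fintype C] [Fintype Q] where
  Step : Config C Q → Config C Q → Prop
  size_eq : ∀ {x y : Config C Q}, Step x y → ∑ q, x.2 q = ∑ q, y.2 q

/-- The order `≼₀`: same controller state, componentwise smaller, and the same user states are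
occupied. -/
def Wqo0 {C Q : Type*} (x y : Config C Q) : Prop :=
  x.1 = y.1 ∧ (∀ q, x.2 q ≤ y.2 q) ∧ ∀ q, x.2 q = 0 ↔ y.2 q = 0

/-- The abstraction function `α`. -/
def absConfig {C Q : Type*} (x : Config C Q) : AbsConfig C Q :=
  (x.1, fun q => decide (1 ≤ x.2 q))

/-- The set of occupied user states of a configuration. -/
def Config.supp {C Q : Type*} (x : Config C Q) : Set Q := {q | 1 ≤ x.2 q}

/-- The set of occupied user states of an abstract configuration. -/
def AbsConfig.supp {C Q : Type*} (x : AbsConfig C Q) : Set Q := {q | x.2 q = true}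

/-- `(c₀, v)` is initial if `v` vanishes outside `Q₀`. -/
def Config.IsInitial {C Q : Type*} (c₀ : C) (Q₀ : Set Q) (x : Config C Q) : Prop :=
  x.1 = c₀ ∧ ∀ q, q ∉ Q₀ → x.2 q = 0

/-- `(c₀, v)` is initial in the 01-abstraction if `v` vanishes outside `Q₀`. -/
def AbsConfig.IsInitial {C Q : Type*} (c₀ : C) (Q₀ : Set Q) (x : AbsConfig C Q) : Prop :=
  x.1 = c₀ ∧ ∀ q, q ∉ Q₀ → x.2 q = false

/-! ### Cardinality constraints with atoms `#q ≥ a` and `#q = 0` -/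

/-- The class `CC[≥ a, = 0]` of cardinality constraints. -/
inductive CardConstraint (Q : Type*) where
  | geq (q : Q) (a : ℕ) : CardConstraint Q
  | eqZero (q : Q) : CardConstraint Q
  | and (φ ψ : CardConstraint Q) : CardConstraint Q
  | or (φ ψ : CardConstraint Q) : CardConstraint Q

namespace CardConstraint

/-- Satisfaction by a vector of counters. -/
def Sat {Q : Type*} (v : Q → ℕ) : CardConstraint Q → Prop
  | geq q a => a ≤ v q
  | eqZero q => v q = 0
  | and φ ψ => φ.Sat v ∧ ψ.Sat v
  | or φ ψ => φ.Sat v ∨ ψ.Sat v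

/-- The constraint `φ_α`: every `#q ≥ a` with `a ≥ 1` is replaced by `#q ≥ 1`. -/
def abs {Q : Type*} : CardConstraint Q → CardConstraint Q
  | geq q a => geq q (min a 1)
  | eqZero q => eqZero q
  | and φ ψ => and φ.abs ψ.abs
  | or φ ψ => or φ.abs ψ.abs

/-- Satisfaction by a 0/1 vector. -/
def AbsSat {Q : Type*} (x : Q → Bool) (φ : CardConstraint Q) : Prop :=
  φ.Sat fun q => (x q).toNat

end CardConstraint

namespace CounterSystem

variable {C Q : Type*} [Fintype C] [Fintype Q]

def ForwardCompatible (S : CounterSystem C Q) : Prop :=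
  ∀ x x' y, S.Step x x' → Wqo0 x y → ∃ y', S.Step y y' ∧ Wqo0 x' y'

def BackwardCompatible (S : CounterSystem C Q) : Prop :=
  ∀ x x' y', S.Step x x' → Wqo0 x' y' → ∃ y, S.Step y y' ∧ Wqo0 x y

/-- `≼₀`-compatibility, in both directions. -/
def Compatible (S : CounterSystem C Q) : Prop :=
  S.ForwardCompatible ∧ S.BackwardCompatible

/-- The steps of the 01-counter system of `S`. -/
def AbsStep (S : CounterSystem C Q) (x y : AbsConfig C Q) : Prop :=
  ∃ v w, S.Step v w ∧ absConfig v = x ∧ absConfig w = y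

/-- The cardinality reachability problem: some configuration that satisfies `φ` is reachable from
an initial configuration. -/
def CRP (S : CounterSystem C Q) (c₀ : C) (Q₀ : Set Q) (φ : CardConstraint Q) : Prop :=
  ∃ x y, Config.IsInitial c₀ Q₀ x ∧ Relation.ReflTransGen S.Step x y ∧ φ.Sat y.2

end CounterSystem

/-- `ρ 0, …, ρ (n + m)` is a path of the relation `R` whose first `n` steps strictly increase the
support and whose last `m` steps strictly decrease it. -/
structure IsUpDownPath {A Q : Type*} (R : A → A → Prop) (supp : A → Set Q) (n m : ℕ)
    (ρ : ℕ → A) : Prop where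
  step : ∀ i < n + m, R (ρ i) (ρ (i + 1))
  up : ∀ i < n, supp (ρ i) ⊂ supp (ρ (i + 1))
  down : ∀ i, n ≤ i → i < n + m → supp (ρ (i + 1)) ⊂ supp (ρ i)

/-! ### Transition counter systems -/

/-- A transition counter system on the user states `Q`, without controller: a set of multisets `D`
of local transitions `p → q`. In the step defined by `D`, the processes taking the transitions
of `D` move simultaneously and all others stay where they are. -/
structure TransitionCS (Q : Type*) where
  steps : Set (Q × Q → ℕ)

namespace TransitionCS

variable {Q : Type*} [Fintype Q]

/-- The multiset of source states of a multiset of transitions. -/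
def pre (D : Q × Q → ℕ) (p : Q) : ℕ := ∑ q, D (p, q)

/-- The multiset of target states of a multiset of transitions. -/
def post (D : Q × Q → ℕ) (q : Q) : ℕ := ∑ p, D (p, q)

/-- The step relation on vectors of counters: some `D` with `pre D ≤ v` is executed, and
`v' = v - pre D + post D`. -/
def Fires (S : TransitionCS Q) (v v' : Q → ℕ) : Prop :=
  ∃ D ∈ S.steps, (∀ q, pre D q ≤ v q) ∧ ∀ q, v' q = v q - pre D q + post D q

theorem Fires.sum_eq {S : TransitionCS Q} {v v' : Q → ℕ} (h : S.Fires v v') :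
    ∑ q, v q = ∑ q, v' q := by
  obtain ⟨D, -, h1, h2⟩ := h
  have h3 : ∑ q, pre D q = ∑ q, post D q := by
    unfold pre post
    exact Finset.sum_comm
  have h4 : ∑ q, v q = ∑ q, (v q - pre D q) + ∑ q, pre D q := by
    rw [← Finset.sum_add_distrib]
    exact Finset.sum_congr rfl fun q _ => (Nat.sub_add_cancel (h1 q)).symm
  rw [h4, h3, ← Finset.sum_add_distrib]
  exact Finset.sum_congr rfl fun q _ => (h2 q).symm

/-- The counter system induced by a transition counter system; the controller is trivial. -/
def toCounterSystem (S : TransitionCS Q) : CounterSystem Unit Q where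
  Step x y := S.Fires x.2 y.2
  size_eq h := h.sum_eq

/-- The set of minimal steps, for the order on multisets of transitions "componentwise smaller,
with the same support". -/
def minSteps (S : TransitionCS Q) : Set (Q × Q → ℕ) :=
  {D | D ∈ S.steps ∧ ∀ D' ∈ S.steps, (∀ t, D' t ≤ D t) → (∀ t, D' t = 0 ↔ D t = 0) → D' = D}

end TransitionCS

/-! ### The class NP -/

/-- The encoding of an instance together with a certificate, over the disjoint union of the two
alphabets. -/
def encodeWithCert {I Γ : Type} (enc : I → List Γ) (x : I × List Bool) : List (Γ ⊕ Bool) :=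
  (enc x.1).map Sum.inl ++ x.2.map Sum.inr

/-- The decision problem `P`, with instances encoded by `enc`, is in NP: there are a polynomial `p`
and a verifier, computable in polynomial time by a Turing machine, such that the yes-instances are
those with an accepted certificate of length at most `p` in the length of the encoded instance. -/
def InNP {I Γ : Type} (enc : I → List Γ) (P : I → Prop) : Prop :=
  ∃ (p : Polynomial ℕ) (V : I × List Bool → Bool),
    Nonempty (TM2ComputableInPolyTime (encodeWithCert enc) encodeBool V) ∧
    ∀ x, P x ↔ ∃ c : List Bool, c.length ≤ p.eval (enc x).length ∧ V (x, c) = true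

/-! ### Instances of the cardinality reachability problem and their encoding -/

/-- The input alphabet. -/
inductive Letter where
  | bit (b : Bool)
  | comma
  | semi
  | geq
  | eqZero
  | and
  | or

/-- An instance: a `≼₀`-compatible transition counter system with user states `0, …, n - 1`, a list
of its minimal steps, the initial states, and a constraint. -/
structure CRPInstance where
  n : ℕ
  sys : TransitionCS (Fin n)
  compatible : sys.toCounterSystem.Compatible
  minList : List (Fin n × Fin n → ℕ)
  mem_minList : ∀ D, D ∈ minList ↔ D ∈ sys.minSteps
  init : Finset (Fin n)
  constraint : CardConstraint (Fin n)

/-- A number in unary, followed by a comma. -/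
def encUnary (k : ℕ) : List Letter := List.replicate k (Letter.bit true) ++ [Letter.comma]

/-- A number in binary, followed by a comma. -/
def encBinary (k : ℕ) : List Letter := (encodeNat k).map Letter.bit ++ [Letter.comma]

/-- A multiset of transitions, as the matrix of its multiplicities in binary, row by row. -/
def encStep {n : ℕ} (D : Fin n × Fin n → ℕ) : List Letter :=
  ((List.finRange n).flatMap fun p => (List.finRange n).flatMap fun q => encBinary (D (p, q))) ++
    [Letter.semi]

/-- A constraint in prefix notation; user states are in unary, lower bounds in binary. -/
def CardConstraint.encode {n : ℕ} : CardConstraint (Fin n) → List Letter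
  | geq q a => Letter.geq :: (encUnary q ++ encBinary a)
  | eqZero q => Letter.eqZero :: encUnary q
  | and φ ψ => Letter.and :: (φ.encode ++ ψ.encode)
  | or φ ψ => Letter.or :: (φ.encode ++ ψ.encode)

/-- The input word: the number of user states in unary, the characteristic vector of the set of
initial states, the list of the minimal steps, and the constraint. -/
def CRPInstance.encode (I : CRPInstance) : List Letter :=
  encUnary I.n ++ (List.finRange I.n).map (fun q => Letter.bit (decide (q ∈ I.init))) ++
    I.minList.flatMap encStep ++ I.constraint.encode

/-- The question asked about an instance. -/
def CRPInstance.Holds (I : CRPInstance) : Prop :=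
  I.sys.toCounterSystem.CRP () I.init I.constraint

/-!
The steps of a transition counter system are additive: if `v → w`, then `v + z → w + z`. Hence the
steps of the 01-abstraction may be united with any fixed set of states, and a path
`A₀ → A₁ → ⋯ → Aₖ` of supports can be normalized: first the supports `A₀ ∪ ⋯ ∪ Aᵢ` grow to the
union of all, then the supports `Aᵢ ∪ ⋯ ∪ Aₖ` shrink to `Aₖ`; steps that change nothing are dropped
(`TransitionCS.exists_up_down`). By compatibility, a path of the 01-abstraction lifts to the counter
system (`CounterSystem.Compatible.exists_lift`), and backward compatibility makes the numbers at its
end as large as the lower bounds in the constraint require. As the lifted path has the same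
supports, it is normalized as well.

For membership in NP, the certificate describes a path of the 01-abstraction. Whether there is a step
from `A` to `B` only depends on the supports of the available multisets `D` of transitions: one needs
a set `R` of states with `A = R ∪ supp (pre D)` and `B = R ∪ supp (post D)`. So the minimal steps
suffice (`TransitionCS.exists_stay_of_absStep`), and of their matrices only the positions of the
nonzero entries matter. The verifier passes through the list of minimal steps, and at each of them
the certificate says whether it is executed, and with which `R`. By the bound on the length of
normalized runs, `2|Q| + 1` passes suffice. Finally the constraint is evaluated, where the
certificate chooses between disjuncts. The certificate is read as an infinite sequence of bits, padded
with `false`, so that there are no malformed certificates.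

The verifier is implemented by a machine with eight stacks, `Verifier.machine`. `Verifier.Runs` bounds
the number of steps between two of its configurations; the bounds for the loops of the program add up
to a cubic polynomial in the length of the input.
-/

/-! ### Normalized runs of the 01-abstraction -/

theorem exists_path_of_reflTransGen {A : Type*} {r : A → A → Prop} {x y : A}
    (h : Relation.ReflTransGen r x y) :
    ∃ (n : ℕ) (ρ : ℕ → A), ρ 0 = x ∧ ρ n = y ∧ ∀ i < n, r (ρ i) (ρ (i + 1)) := by
  induction h with
  | refl => exact ⟨0, fun _ => x, rfl, rfl, by simp⟩
  | @tail b c _ hbc ih =>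
    obtain ⟨n, ρ, h0, hn, hs⟩ := ih
    refine ⟨n + 1, fun i => if i ≤ n then ρ i else c, by simp [h0], by simp, fun i hi => ?_⟩
    rcases Nat.lt_succ_iff_lt_or_eq.1 hi with hi | rfl
    · have h2 : i + 1 ≤ n := hi
      simpa [hi.le, h2] using hs i hi
    · simpa [hn] using hbc

theorem reflTransGen_of_path {A : Type*} {r : A → A → Prop} {n : ℕ} {ρ : ℕ → A}
    (h : ∀ i < n, r (ρ i) (ρ (i + 1))) : Relation.ReflTransGen r (ρ 0) (ρ n) := by
  induction n with
  | zero => exact .refl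
  | succ n ih => exact (ih fun i hi => h i (by omega)).tail (h n (by omega))

/-- A chain of strictly growing supports followed by a chain of strictly shrinking ones has at
most `2|Q|` steps. -/
theorem exists_isUpDownPath {A Q : Type*} [Fintype Q] {R : A → A → Prop} {supp : A → Set Q}
    {x u y : A} (hup : Relation.ReflTransGen (fun a b => R a b ∧ supp a ⊂ supp b) x u)
    (hdown : Relation.ReflTransGen (fun a b => R a b ∧ supp b ⊂ supp a) u y) :
    ∃ (n m : ℕ) (ρ : ℕ → A), IsUpDownPath R supp n m ρ ∧ n + m ≤ 2 * Fintype.card Q ∧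
      ρ 0 = x ∧ ρ (n + m) = y := by
  obtain ⟨n, ρ, h0, hn, hs⟩ := exists_path_of_reflTransGen hup
  obtain ⟨m, τ, k0, km, ks⟩ := exists_path_of_reflTransGen hdown
  have hcard : ∀ s : Set Q, s.ncard ≤ Fintype.card Q := fun s => by
    rw [← Nat.card_eq_fintype_card]; exact Set.ncard_le_card s
  have hn' : ∀ i ≤ n, i ≤ (supp (ρ i)).ncard := by
    intro i
    induction i with
    | zero => simp
    | succ i ih =>
      intro hi
      have := Set.ncard_lt_ncard (hs i hi).2 (Set.toFinite _)
      have := ih (by omega)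
      omega
  have hm' : ∀ i ≤ m, i + (supp (τ i)).ncard ≤ Fintype.card Q := by
    intro i
    induction i with
    | zero => intro _; simpa using hcard _
    | succ i ih =>
      intro hi
      have := Set.ncard_lt_ncard (ks i hi).2 (Set.toFinite _)
      have := ih (by omega)
      omega
  have key : ∀ i, n ≤ i → (if i ≤ n then ρ i else τ (i - n)) = τ (i - n) := by
    intro i hi
    rcases hi.eq_or_lt with rfl | hi
    · simp [hn, k0]
    · rw [if_neg (by omega)]
  have hlow : ∀ i < n, R (if i ≤ n then ρ i else τ (i - n))
        (if i + 1 ≤ n then ρ (i + 1) else τ (i + 1 - n)) ∧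
      supp (if i ≤ n then ρ i else τ (i - n)) ⊂
        supp (if i + 1 ≤ n then ρ (i + 1) else τ (i + 1 - n)) := by
    intro i hi
    rw [if_pos (by omega), if_pos (by omega)]
    exact hs i hi
  have hhigh : ∀ i, n ≤ i → i < n + m → R (if i ≤ n then ρ i else τ (i - n))
        (if i + 1 ≤ n then ρ (i + 1) else τ (i + 1 - n)) ∧
      supp (if i + 1 ≤ n then ρ (i + 1) else τ (i + 1 - n)) ⊂
        supp (if i ≤ n then ρ i else τ (i - n)) := by
    intro i h1 h2
    rw [key i h1, key (i + 1) (by omega), Nat.sub_add_comm h1]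
    exact ks (i - n) (by omega)
  refine ⟨n, m, fun i => if i ≤ n then ρ i else τ (i - n), ⟨fun i hi => ?_, fun i hi => ?_,
    fun i h1 h2 => ?_⟩, ?_, ?_, ?_⟩
  · rcases lt_or_ge i n with h | h
    · exact (hlow i h).1
    · exact (hhigh i h hi).1
  · exact (hlow i hi).2
  · exact (hhigh i h1 h2).2
  · have := (hn' n le_rfl).trans (hcard _)
    have := hm' m le_rfl
    omega
  · simp [h0]
  · simpa [km] using key (n + m) (by omega)

/-- The union of two configurations of the 01-abstraction of a system without controller. -/
def AbsConfig.union {Q : Type*} (x z : AbsConfig Unit Q) : AbsConfig Unit Q :=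
  ((), fun q => x.2 q || z.2 q)

theorem AbsConfig.ext_iff_supp {Q : Type*} {x y : AbsConfig Unit Q} : x = y ↔ x.supp = y.supp := by
  refine ⟨fun h => h ▸ rfl, fun h => Prod.ext rfl (funext fun q => ?_)⟩
  have : q ∈ x.supp ↔ q ∈ y.supp := by rw [h]
  exact Bool.eq_iff_iff.2 this

theorem AbsConfig.supp_union {Q : Type*} (x z : AbsConfig Unit Q) :
    (x.union z).supp = x.supp ∪ z.supp := by
  ext q
  simp [AbsConfig.supp, AbsConfig.union]

theorem supp_absConfig {C Q : Type*} (x : Config C Q) : (absConfig x).supp = x.supp := by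
  ext q
  simp [AbsConfig.supp, absConfig, Config.supp]

namespace TransitionCS

variable {Q : Type*} [Fintype Q]

/-- Processes that do not take part in a step may be added on both sides. -/
theorem Fires.add {S : TransitionCS Q} {v w : Q → ℕ} (h : S.Fires v w) (z : Q → ℕ) :
    S.Fires (v + z) (w + z) := by
  obtain ⟨D, hD, h1, h2⟩ := h
  refine ⟨D, hD, fun q => (h1 q).trans (Nat.le_add_right _ _), fun q => ?_⟩
  have := h1 q
  have := h2 q
  simp only [Pi.add_apply]
  omega

theorem absStep_union {S : TransitionCS Q} {x y : AbsConfig Unit Q}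
    (h : S.toCounterSystem.AbsStep x y) (z : AbsConfig Unit Q) :
    S.toCounterSystem.AbsStep (x.union z) (y.union z) := by
  obtain ⟨v, w, hs, rfl, rfl⟩ := h
  have aux : ∀ u : Config Unit Q,
      absConfig ((), u.2 + fun q => (z.2 q).toNat) = (absConfig u).union z := by
    intro u
    refine Prod.ext rfl (funext fun q => ?_)
    cases hz : z.2 q <;> simp [absConfig, AbsConfig.union, hz]
  exact ⟨((), v.2 + fun q => (z.2 q).toNat), ((), w.2 + fun q => (z.2 q).toNat), hs.add _,
    aux v, aux w⟩

/-- A path can be rearranged such that it first collects all states that occur on it, which form the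
support of `u`, and then drops those that do not occur any more. By induction: for a first step
`x → x'`, the path up from `x'` to `u` is united with `x`, and the step `x ∪ u → x' ∪ u = u` is put in
front of the path down. -/
theorem exists_up_down {S : TransitionCS Q} {x y : AbsConfig Unit Q}
    (h : Relation.ReflTransGen S.toCounterSystem.AbsStep x y) :
    ∃ u : AbsConfig Unit Q,
      Relation.ReflTransGen
        (fun a b => S.toCounterSystem.AbsStep a b ∧ AbsConfig.supp a ⊂ AbsConfig.supp b) x u ∧
      Relation.ReflTransGen
        (fun a b => S.toCounterSystem.AbsStep a b ∧ AbsConfig.supp b ⊂ AbsConfig.supp a) u y ∧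
      AbsConfig.supp x ⊆ AbsConfig.supp u := by
  induction h using Relation.ReflTransGen.head_induction_on with
  | refl => exact ⟨y, .refl, .refl, subset_rfl⟩
  | @head x x' hx _ ih =>
    obtain ⟨u, hup, hdown, hsub⟩ := ih
    have refl_or : ∀ {a b : AbsConfig Unit Q}, S.toCounterSystem.AbsStep a b →
        a.supp ⊆ b.supp → Relation.ReflTransGen
        (fun a b => S.toCounterSystem.AbsStep a b ∧ AbsConfig.supp a ⊂ AbsConfig.supp b) a b := by
      intro a b hab hs
      rcases hs.eq_or_ssubset with h | h
      · rw [AbsConfig.ext_iff_supp.2 h]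
      · exact .single ⟨hab, h⟩
    have hself : x.union x = x := AbsConfig.ext_iff_supp.2 (by simp [AbsConfig.supp_union])
    refine ⟨u.union x, ?_, ?_, by simp [AbsConfig.supp_union]⟩
    · have h1 := absStep_union hx x
      rw [hself] at h1
      refine (refl_or h1 (by simp [AbsConfig.supp_union])).trans ?_
      clear hsub hdown
      induction hup with
      | refl => exact .refl
      | tail _ hbc ih =>
        refine ih.trans (refl_or (absStep_union hbc.1 x) ?_)
        simp only [AbsConfig.supp_union]
        exact Set.union_subset_union_left _ hbc.2.1
    · have h1 := absStep_union hx u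
      have h2 : x'.union u = u := AbsConfig.ext_iff_supp.2 (by
        rw [AbsConfig.supp_union, Set.union_eq_right.2 hsub])
      have h3 : x.union u = u.union x := AbsConfig.ext_iff_supp.2 (by
        simp only [AbsConfig.supp_union, Set.union_comm])
      rw [h2, h3] at h1
      have h4 : u.supp ⊆ (u.union x).supp := by simp [AbsConfig.supp_union]
      rcases h4.eq_or_ssubset with h | h
      · rwa [← AbsConfig.ext_iff_supp.2 h]
      · exact hdown.head ⟨h1, h⟩

theorem exists_normalized_path {S : TransitionCS Q} {x y : AbsConfig Unit Q}
    (h : Relation.ReflTransGen S.toCounterSystem.AbsStep x y) :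
    ∃ (n m : ℕ) (ρ : ℕ → AbsConfig Unit Q),
      IsUpDownPath S.toCounterSystem.AbsStep AbsConfig.supp n m ρ ∧
      n + m ≤ 2 * Fintype.card Q ∧ ρ 0 = x ∧ ρ (n + m) = y := by
  obtain ⟨u, h1, h2, -⟩ := exists_up_down h
  exact exists_isUpDownPath h1 h2

end TransitionCS

/-! ### Lifting runs of the 01-abstraction -/

theorem wqo0_iff {C Q : Type*} {x y : Config C Q} :
    Wqo0 x y ↔ absConfig x = absConfig y ∧ ∀ q, x.2 q ≤ y.2 q := by
  have key : ∀ q, (decide (1 ≤ x.2 q) = decide (1 ≤ y.2 q)) ↔ (x.2 q = 0 ↔ y.2 q = 0) := by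
    intro q
    rw [decide_eq_decide]
    omega
  simp only [Wqo0, absConfig, Prod.mk.injEq, funext_iff, key]
  tauto

namespace CounterSystem

variable {C Q : Type*} [Fintype C] [Fintype Q] {S : CounterSystem C Q}

/-- Backward compatibility along a path. -/
theorem BackwardCompatible.exists_path (hS : S.BackwardCompatible) {k : ℕ} {σ : ℕ → Config C Q}
    (hσ : ∀ i < k, S.Step (σ i) (σ (i + 1))) {y : Config C Q} (hy : Wqo0 (σ k) y) :
    ∃ τ : ℕ → Config C Q, (∀ i < k, S.Step (τ i) (τ (i + 1))) ∧ (∀ i ≤ k, Wqo0 (σ i) (τ i)) ∧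
      τ k = y := by
  induction k generalizing y with
  | zero => exact ⟨fun _ => y, by simp, by simpa using hy, rfl⟩
  | succ k ih =>
    obtain ⟨z, hz, hw⟩ := hS _ _ _ (hσ k (by omega)) hy
    obtain ⟨τ, h1, h2, h3⟩ := ih (fun i hi => hσ i (by omega)) hw
    refine ⟨fun i => if i ≤ k then τ i else y, fun i hi => ?_, fun i hi => ?_, by simp⟩
    · rcases Nat.lt_succ_iff_lt_or_eq.1 hi with hi | rfl
      · have h4 : i + 1 ≤ k := hi
        simpa [hi.le, h4] using h1 i hi
      · simpa [h3] using hz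
    · rcases Nat.le_succ_iff.1 hi with hi | rfl
      · simpa [hi] using h2 i hi
      · simpa using hy

/-- A path of the 01-abstraction lifts to a path of the counter system: the componentwise maximum
of the last configuration reached and of the source of the next step lies above both, so that
backward compatibility moves the path, and forward compatibility moves the step, to it. -/
theorem Compatible.exists_lift (hS : S.Compatible) {k : ℕ} {ρ : ℕ → AbsConfig C Q}
    (hρ : ∀ i < k, S.AbsStep (ρ i) (ρ (i + 1))) :
    ∃ σ : ℕ → Config C Q, (∀ i < k, S.Step (σ i) (σ (i + 1))) ∧
      ∀ i ≤ k, absConfig (σ i) = ρ i := by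
  induction k with
  | zero =>
    refine ⟨fun _ => ((ρ 0).1, fun q => ((ρ 0).2 q).toNat), by simp, fun i hi => ?_⟩
    obtain rfl : i = 0 := by omega
    refine Prod.ext rfl (funext fun q => ?_)
    cases h : (ρ 0).2 q <;> simp [absConfig, h]
  | succ k ih =>
    obtain ⟨σ, h1, h2⟩ := ih fun i hi => hρ i (by omega)
    obtain ⟨v, w, hvw, hv, hw⟩ := hρ k (by omega)
    have hk := h2 k le_rfl
    have hvk : absConfig v = absConfig (σ k) := hv.trans hk.symm
    have hq : ∀ q, 1 ≤ v.2 q ↔ 1 ≤ (σ k).2 q := fun q => by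
      have := congrFun (congrArg Prod.snd hvk) q
      simpa [absConfig] using this
    set z : Config C Q := (v.1, fun q => max (v.2 q) ((σ k).2 q)) with hz
    have hvz : Wqo0 v z := ⟨rfl, fun q => le_max_left _ _, fun q => by
      have := hq q
      simp only [hz]; omega⟩
    have hkz : Wqo0 (σ k) z := ⟨(congrArg Prod.fst hvk).symm, fun q => le_max_right _ _, fun q => by
      have := hq q
      simp only [hz]; omega⟩
    obtain ⟨z', hzz', hwz'⟩ := hS.1 _ _ _ hvw hvz
    obtain ⟨τ, t1, t2, t3⟩ := hS.2.exists_path h1 hkz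
    refine ⟨fun i => if i ≤ k then τ i else z', fun i hi => ?_, fun i hi => ?_⟩
    · rcases Nat.lt_succ_iff_lt_or_eq.1 hi with hi | rfl
      · have h4 : i + 1 ≤ k := hi
        simpa [hi.le, h4] using t1 i hi
      · simpa [t3] using hzz'
    · rcases Nat.le_succ_iff.1 hi with hi | rfl
      · simpa [hi] using (wqo0_iff.1 (t2 i hi)).1.symm.trans (h2 i hi)
      · simpa using (wqo0_iff.1 hwz').1.symm.trans hw

/-- The lifted path can be chosen such that every occupied state holds at least `N` processes at
the end. -/
theorem Compatible.exists_lift_ge (hS : S.Compatible) {k : ℕ} {ρ : ℕ → AbsConfig C Q}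
    (hρ : ∀ i < k, S.AbsStep (ρ i) (ρ (i + 1))) (N : ℕ) :
    ∃ σ : ℕ → Config C Q, (∀ i < k, S.Step (σ i) (σ (i + 1))) ∧
      (∀ i ≤ k, absConfig (σ i) = ρ i) ∧ ∀ q, (ρ k).2 q = true → N ≤ (σ k).2 q := by
  obtain ⟨σ, h1, h2⟩ := hS.exists_lift hρ
  obtain ⟨τ, t1, t2, t3⟩ := hS.2.exists_path h1
    (y := ((σ k).1, fun q => (σ k).2 q * (N + 1)))
    ⟨rfl, fun q => Nat.le_mul_of_pos_right _ (by omega), fun q => by simp⟩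
  refine ⟨τ, t1, fun i hi => (wqo0_iff.1 (t2 i hi)).1.symm.trans (h2 i hi), fun q hq => ?_⟩
  rw [← h2 k le_rfl] at hq
  have h3 : 1 ≤ (σ k).2 q := by simpa [absConfig] using hq
  rw [t3]
  change N ≤ (σ k).2 q * (N + 1)
  nlinarith

end CounterSystem

namespace CardConstraint

variable {Q : Type*}

theorem Sat.absSat {C : Type*} {φ : CardConstraint Q} {x : Config C Q} (h : φ.Sat x.2) :
    φ.abs.AbsSat (absConfig x).2 := by
  unfold AbsSat
  induction φ with
  | geq q a =>
    simp only [Sat, abs, absConfig] at *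
    by_cases h1 : 1 ≤ x.2 q
    · simp [h1]
    · simp [h1]; omega
  | eqZero q => simp only [Sat, abs, absConfig] at *; simp [h]
  | and φ ψ ih1 ih2 => exact ⟨ih1 h.1, ih2 h.2⟩
  | or φ ψ ih1 ih2 => exact h.imp ih1 ih2

/-- Lower bounds hold as soon as the occupied states hold enough processes. -/
theorem AbsSat.exists_sat {φ : CardConstraint Q} {x : Q → Bool} (h : φ.abs.AbsSat x) :
    ∃ N : ℕ, ∀ v : Q → ℕ, (∀ q, x q = false → v q = 0) → (∀ q, x q = true → N ≤ v q) →
      φ.Sat v := by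
  unfold AbsSat at h
  induction φ with
  | geq q a =>
    refine ⟨a, fun v _ h2 => ?_⟩
    simp only [Sat, abs] at *
    cases hq : x q
    · simp [hq] at h; omega
    · exact h2 q hq
  | eqZero q =>
    refine ⟨0, fun v h1 _ => h1 q ?_⟩
    cases hq : x q
    · rfl
    · simp [Sat, abs, hq] at h
  | and φ ψ ih1 ih2 =>
    obtain ⟨N1, h1⟩ := ih1 h.1
    obtain ⟨N2, h2⟩ := ih2 h.2
    exact ⟨max N1 N2, fun v hv hN => ⟨h1 v hv fun q hq => (le_max_left _ _).trans (hN q hq),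
      h2 v hv fun q hq => (le_max_right _ _).trans (hN q hq)⟩⟩
  | or φ ψ ih1 ih2 =>
    rcases h with h | h
    · obtain ⟨N, h1⟩ := ih1 h
      exact ⟨N, fun v hv hN => Or.inl (h1 v hv hN)⟩
    · obtain ⟨N, h1⟩ := ih2 h
      exact ⟨N, fun v hv hN => Or.inr (h1 v hv hN)⟩

end CardConstraint

namespace CounterSystem

variable {C Q : Type*} [Fintype C] [Fintype Q] {S : CounterSystem C Q}

/-- A path of the 01-abstraction from an initial configuration to one that satisfies `φ_α` is the
abstraction of a path from an initial configuration to one that satisfies `φ`. -/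
theorem Compatible.exists_lift_sat (hS : S.Compatible) {k : ℕ} {ρ : ℕ → AbsConfig C Q}
    (hρ : ∀ i < k, S.AbsStep (ρ i) (ρ (i + 1))) {c₀ : C} {Q₀ : Set Q}
    (h0 : AbsConfig.IsInitial c₀ Q₀ (ρ 0)) {φ : CardConstraint Q}
    (hφ : φ.abs.AbsSat (ρ k).2) :
    ∃ σ : ℕ → Config C Q, (∀ i < k, S.Step (σ i) (σ (i + 1))) ∧
      (∀ i ≤ k, absConfig (σ i) = ρ i) ∧ Config.IsInitial c₀ Q₀ (σ 0) ∧ φ.Sat (σ k).2 := by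
  obtain ⟨N, hN⟩ := hφ.exists_sat
  obtain ⟨σ, h1, h2, h3⟩ := hS.exists_lift_ge hρ N
  have hzero : ∀ i ≤ k, ∀ q, (ρ i).2 q = false → (σ i).2 q = 0 := fun i hi q hq => by
    rw [← h2 i hi] at hq
    simpa [absConfig] using hq
  refine ⟨σ, h1, h2, ⟨?_, fun q hq => hzero 0 (Nat.zero_le _) q (h0.2 q hq)⟩,
    hN _ (hzero k le_rfl) h3⟩
  rw [← h0.1, ← h2 0 (Nat.zero_le _)]
  rfl

theorem CRP.exists_abs {c₀ : C} {Q₀ : Set Q} {φ : CardConstraint Q} (h : S.CRP c₀ Q₀ φ) :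
    ∃ x y : AbsConfig C Q, AbsConfig.IsInitial c₀ Q₀ x ∧ Relation.ReflTransGen S.AbsStep x y ∧
      φ.abs.AbsSat y.2 := by
  obtain ⟨x, y, hx, hxy, hy⟩ := h
  exact ⟨absConfig x, absConfig y, ⟨hx.1, fun q hq => by simp [absConfig, hx.2 q hq]⟩,
    hxy.lift absConfig fun a b hab => ⟨a, b, hab, rfl, rfl⟩, hy.absSat⟩

theorem Compatible.crp_of_abs (hS : S.Compatible) {c₀ : C} {Q₀ : Set Q} {φ : CardConstraint Q}
    {x y : AbsConfig C Q} (hx : AbsConfig.IsInitial c₀ Q₀ x)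
    (hxy : Relation.ReflTransGen S.AbsStep x y) (hy : φ.abs.AbsSat y.2) : S.CRP c₀ Q₀ φ := by
  obtain ⟨k, ρ, rfl, rfl, hρ⟩ := exists_path_of_reflTransGen hxy
  obtain ⟨σ, h1, -, h3, h4⟩ := hS.exists_lift_sat hρ hx hy
  exact ⟨σ 0, σ k, h3, reflTransGen_of_path h1, h4⟩

end CounterSystem

/-- Normalized runs decide the cardinality reachability problem. -/
theorem TransitionCS.normalized_runs {Q : Type*} [Fintype Q] (S : TransitionCS Q)
    (hS : S.toCounterSystem.Compatible) (Q₀ : Set Q) (φ : CardConstraint Q) :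
    (S.toCounterSystem.CRP () Q₀ φ ↔
      ∃ (n m : ℕ) (ρ : ℕ → AbsConfig Unit Q),
        IsUpDownPath S.toCounterSystem.AbsStep AbsConfig.supp n m ρ ∧
        n + m ≤ 2 * Fintype.card Q ∧ AbsConfig.IsInitial () Q₀ (ρ 0) ∧
        φ.abs.AbsSat (ρ (n + m)).2) ∧
    (S.toCounterSystem.CRP () Q₀ φ →
      ∃ (n m : ℕ) (ρ : ℕ → Config Unit Q),
        IsUpDownPath S.toCounterSystem.Step Config.supp n m ρ ∧
        n + m ≤ 2 * Fintype.card Q ∧ Config.IsInitial () Q₀ (ρ 0) ∧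
        φ.Sat (ρ (n + m)).2) := by
  have key : S.toCounterSystem.CRP () Q₀ φ →
      ∃ (n m : ℕ) (ρ : ℕ → AbsConfig Unit Q),
        IsUpDownPath S.toCounterSystem.AbsStep AbsConfig.supp n m ρ ∧
        n + m ≤ 2 * Fintype.card Q ∧ AbsConfig.IsInitial () Q₀ (ρ 0) ∧
        φ.abs.AbsSat (ρ (n + m)).2 := by
    intro h
    obtain ⟨x, y, hx, hxy, hy⟩ := h.exists_abs
    obtain ⟨n, m, ρ, h1, h2, rfl, rfl⟩ := exists_normalized_path hxy
    exact ⟨n, m, ρ, h1, h2, hx, hy⟩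
  refine ⟨⟨key, ?_⟩, fun h => ?_⟩
  · rintro ⟨n, m, ρ, h1, -, h3, h4⟩
    exact hS.crp_of_abs h3 (reflTransGen_of_path h1.step) h4
  · obtain ⟨n, m, ρ, h1, h2, h3, h4⟩ := key h
    obtain ⟨σ, s1, s2, s3, s4⟩ := hS.exists_lift_sat h1.step h3 h4
    have hsupp : ∀ i ≤ n + m, (σ i).supp = (ρ i).supp := fun i hi => by
      rw [← s2 i hi, supp_absConfig]
    refine ⟨n, m, σ, ⟨s1, fun i hi => ?_, fun i hi hi' => ?_⟩, h2, s3, s4⟩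
    · rw [hsupp i (by omega), hsupp (i + 1) (by omega)]
      exact h1.up i hi
    · rw [hsupp i (by omega), hsupp (i + 1) (by omega)]
      exact h1.down i hi hi'

/-! ### The verifier -/

/-- The state of the verifier: whether all checks have succeeded so far, the current configuration
of the 01-abstraction, and the unread part of the certificate. An exhausted certificate is read as
an infinite supply of `false`. -/
@[ext]
structure VerifierState (n : ℕ) where
  ok : Bool
  conf : Fin n → Bool
  cert : List Bool

namespace VerifierState

variable {n : ℕ}

/-- The states that stay occupied while a step is executed: they are read from the certificate if
the step is selected; otherwise all occupied states stay occupied. -/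
def stay (sel : Bool) (A : Fin n → Bool) (c : List Bool) : Fin n → Bool :=
  fun p => if sel then c.getD p false else A p

/-- The certificate decides whether `D` is executed; if so, it supplies the set `R` of states in
which processes stay behind. The step leads from `R ∪ supp (pre D)` to `R ∪ supp (post D)`, and the
verifier checks that the former is the current configuration. -/
def process (s : VerifierState n) (D : Fin n × Fin n → ℕ) : VerifierState n where
  ok := s.ok && (List.finRange n).all fun p =>
    s.conf p == (stay (s.cert.headD false) s.conf s.cert.tail p ||
      (List.finRange n).any fun q => s.cert.headD false && decide (D (p, q) ≠ 0))
  conf q := stay (s.cert.headD false) s.conf s.cert.tail q ||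
    (List.finRange n).any fun p => s.cert.headD false && decide (D (p, q) ≠ 0)
  cert := s.cert.tail.drop n

/-- One pass through the list of steps. -/
def pass (Ds : List (Fin n × Fin n → ℕ)) (s : VerifierState n) : VerifierState n :=
  Ds.foldl process s

/-- Passes through the list of steps, until the certificate does not ask for another one, at most
as many as the fuel allows. -/
def passes (Ds : List (Fin n × Fin n → ℕ)) : ℕ → VerifierState n → VerifierState n
  | 0, s => s
  | k + 1, s =>
    if (pass Ds s).cert.headD false then
      passes Ds k { pass Ds s with cert := (pass Ds s).cert.tail }
    else { pass Ds s with cert := (pass Ds s).cert.tail }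

end VerifierState

/-- Evaluation of the constraint `φ_α`, where the certificate chooses between disjuncts. The flag
`m` says whether `φ` has to hold; if it is not set, then `φ` is only read. The result is the outcome
and the unread part of the certificate. -/
def CardConstraint.check {n : ℕ} (A : Fin n → Bool) :
    CardConstraint (Fin n) → Bool → List Bool → Bool × List Bool
  | geq q a, m, c => (!m || decide (a = 0) || A q, c)
  | eqZero q, m, c => (!m || !A q, c)
  | and φ ψ, m, c =>
    ((φ.check A m c).1 && (ψ.check A m (φ.check A m c).2).1, (ψ.check A m (φ.check A m c).2).2)
  | or φ ψ, m, c =>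
    ((φ.check A (m && c.headD false) c.tail).1 &&
        (ψ.check A (m && !c.headD false) (φ.check A (m && c.headD false) c.tail).2).1,
      (ψ.check A (m && !c.headD false) (φ.check A (m && c.headD false) c.tail).2).2)

namespace CRPInstance

/-- The certificate supplies, from the last user state to the first, which of the states in `Q₀`
are occupied initially. -/
def initialState (I : CRPInstance) (c : List Bool) : VerifierState I.n where
  ok := true
  conf p := decide (p ∈ I.init) && c.getD (I.n - 1 - p) false
  cert := c.drop I.n

/-- The state of the verifier after the last pass. -/
def finalState (I : CRPInstance) (c : List Bool) : VerifierState I.n :=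
  VerifierState.passes I.minList (c.length + 1) (I.initialState c)

/-- The verifier for the cardinality reachability problem. -/
def accepts (x : CRPInstance × List Bool) : Bool :=
  (x.1.finalState x.2).ok &&
    (x.1.constraint.check (x.1.finalState x.2).conf true (x.1.finalState x.2).cert).1

end CRPInstance

/-! ### Soundness of the verifier -/

namespace TransitionCS

variable {Q : Type*} [Fintype Q]

theorem pre_ne_zero {D : Q × Q → ℕ} {p : Q} : pre D p ≠ 0 ↔ ∃ q, D (p, q) ≠ 0 := by
  simp [pre, Finset.sum_eq_zero_iff]

theorem post_ne_zero {D : Q × Q → ℕ} {q : Q} : post D q ≠ 0 ↔ ∃ p, D (p, q) ≠ 0 := by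
  simp [post, Finset.sum_eq_zero_iff]

/-- `D` leads from `R ∪ supp (pre D)` to `R ∪ supp (post D)`: put one process into each state of `R`,
and in addition the processes that take part in the step. -/
theorem absStep_of_stay {S : TransitionCS Q} {D : Q × Q → ℕ} (hD : D ∈ S.steps)
    {A B R : Q → Bool} (hA : ∀ p, A p = true ↔ R p = true ∨ ∃ q, D (p, q) ≠ 0)
    (hB : ∀ q, B q = true ↔ R q = true ∨ ∃ p, D (p, q) ≠ 0) :
    S.toCounterSystem.AbsStep ((), A) ((), B) := by
  refine ⟨((), fun q => (R q).toNat + pre D q), ((), fun q => (R q).toNat + post D q),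
    ⟨D, hD, fun q => Nat.le_add_left _ _, fun q => by simp⟩, ?_, ?_⟩
  · refine Prod.ext rfl (funext fun q => ?_)
    rw [Bool.eq_iff_iff, hA, ← pre_ne_zero]
    cases h : R q <;> simp [absConfig, h, Nat.one_le_iff_ne_zero]
  · refine Prod.ext rfl (funext fun q => ?_)
    rw [Bool.eq_iff_iff, hB, ← post_ne_zero]
    cases h : R q <;> simp [absConfig, h, Nat.one_le_iff_ne_zero]

theorem exists_minSteps_le {S : TransitionCS Q} {D : Q × Q → ℕ} (hD : D ∈ S.steps) :
    ∃ D' ∈ S.minSteps, ∀ t, D' t = 0 ↔ D t = 0 := by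
  -- a multiset of transitions of least size among those with the support of `D` is minimal
  have hne : {k | ∃ D' ∈ S.steps, (∀ t, D' t = 0 ↔ D t = 0) ∧ ∑ t, D' t = k}.Nonempty :=
    ⟨_, D, hD, fun _ => Iff.rfl, rfl⟩
  obtain ⟨D', hD', h0, hk⟩ := Nat.sInf_mem hne
  refine ⟨D', ⟨hD', fun E hE hle hE0 => ?_⟩, h0⟩
  have hmin : ∑ t, D' t ≤ ∑ t, E t := by
    rw [hk]
    exact Nat.sInf_le ⟨E, hE, fun t => (hE0 t).trans (h0 t), rfl⟩
  have heq : ∑ t, E t = ∑ t, D' t := le_antisymm (Finset.sum_le_sum fun t _ => hle t) hmin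
  exact funext fun t => (Finset.sum_eq_sum_iff_of_le fun t _ => hle t).1 heq t (Finset.mem_univ t)

/-- The steps of the 01-abstraction only depend on the supports of the multisets of transitions, so
that the minimal ones suffice. -/
theorem exists_stay_of_absStep {S : TransitionCS Q} {A B : Q → Bool}
    (h : S.toCounterSystem.AbsStep ((), A) ((), B)) :
    ∃ D ∈ S.minSteps, ∃ R : Q → Bool, (∀ p, A p = true ↔ R p = true ∨ ∃ q, D (p, q) ≠ 0) ∧
      ∀ q, B q = true ↔ R q = true ∨ ∃ p, D (p, q) ≠ 0 := by
  obtain ⟨v, w, ⟨D, hD, h1, h2⟩, hv, hw⟩ := h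
  obtain ⟨D', hD', h0⟩ := exists_minSteps_le hD
  obtain rfl : (fun q => decide (1 ≤ v.2 q)) = A := congrArg Prod.snd hv
  obtain rfl : (fun q => decide (1 ≤ w.2 q)) = B := congrArg Prod.snd hw
  refine ⟨D', hD', fun q => decide (pre D q < v.2 q), fun p => ?_, fun q => ?_⟩
  · have h3 := h1 p
    simp only [ne_eq, h0]
    rw [← pre_ne_zero]
    simp only [decide_eq_true_eq]
    omega
  · have h3 := h2 q
    simp only [ne_eq, h0]
    rw [← post_ne_zero]
    simp only [decide_eq_true_eq]
    omega

end TransitionCS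

namespace VerifierState

variable {n : ℕ} {S : TransitionCS (Fin n)} {Ds : List (Fin n × Fin n → ℕ)}

theorem process_sound {s : VerifierState n} {D : Fin n × Fin n → ℕ} (hD : D ∈ S.steps)
    (h : (s.process D).ok = true) :
    s.ok = true ∧
      Relation.ReflTransGen S.toCounterSystem.AbsStep ((), s.conf) ((), (s.process D).conf) := by
  simp only [process, Bool.and_eq_true, List.all_eq_true, List.mem_finRange, forall_const,
    beq_iff_eq] at h
  refine ⟨h.1, ?_⟩
  cases hsel : s.cert.headD false
  · have : (s.process D).conf = s.conf := by
      funext q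
      simp only [process, stay, hsel]
      simp
    rw [this]
  · refine .single (TransitionCS.absStep_of_stay (R := stay true s.conf s.cert.tail) hD
      (fun p => ?_) fun q => ?_)
    · rw [h.2 p, hsel]
      simp
    · simp only [process, hsel]
      simp

theorem pass_sound (hDs : ∀ D ∈ Ds, D ∈ S.steps) {s : VerifierState n}
    (h : (pass Ds s).ok = true) :
    s.ok = true ∧
      Relation.ReflTransGen S.toCounterSystem.AbsStep ((), s.conf) ((), (pass Ds s).conf) := by
  induction Ds generalizing s with
  | nil => exact ⟨h, .refl⟩
  | cons D Ds ih =>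
    obtain ⟨h1, h2⟩ := ih (fun E hE => hDs E (List.mem_cons_of_mem _ hE)) (s := s.process D) h
    obtain ⟨h3, h4⟩ := process_sound (hDs D List.mem_cons_self) h1
    exact ⟨h3, h4.trans h2⟩

theorem passes_sound (hDs : ∀ D ∈ Ds, D ∈ S.steps) {k : ℕ} {s : VerifierState n}
    (h : (passes Ds k s).ok = true) :
    s.ok = true ∧
      Relation.ReflTransGen S.toCounterSystem.AbsStep ((), s.conf) ((), (passes Ds k s).conf) := by
  induction k generalizing s with
  | zero => exact ⟨h, .refl⟩
  | succ k ih =>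
    rw [passes] at h ⊢
    split_ifs at h ⊢ with hc
    · obtain ⟨h1, h2⟩ := ih h
      obtain ⟨h3, h4⟩ := pass_sound hDs h1
      exact ⟨h3, h4.trans h2⟩
    · exact pass_sound hDs h

end VerifierState

theorem CardConstraint.absSat_of_check {n : ℕ} {A : Fin n → Bool} {φ : CardConstraint (Fin n)}
    {c : List Bool} (h : (φ.check A true c).1 = true) : φ.abs.AbsSat A := by
  unfold AbsSat
  induction φ generalizing c with
  | geq q a =>
    simp only [check, Bool.not_true, Bool.false_or, Bool.or_eq_true, decide_eq_true_eq] at h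
    rcases h with rfl | h
    · simp [abs, Sat]
    · simp [abs, Sat, h]
  | eqZero q =>
    simp only [check, Bool.not_true, Bool.false_or, Bool.not_eq_true'] at h
    simp [abs, Sat, h]
  | and φ ψ ih1 ih2 =>
    simp only [check, Bool.and_eq_true] at h
    exact ⟨ih1 h.1, ih2 h.2⟩
  | or φ ψ ih1 ih2 =>
    simp only [check, Bool.and_eq_true, Bool.true_and] at h
    cases hc : c.headD false
    · rw [hc] at h
      exact Or.inr (ih2 h.2)
    · rw [hc] at h
      exact Or.inl (ih1 h.1)

theorem CRPInstance.holds_of_accepts {I : CRPInstance} {c : List Bool}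
    (h : accepts (I, c) = true) : I.Holds := by
  simp only [accepts, Bool.and_eq_true] at h
  obtain ⟨-, h2⟩ := VerifierState.passes_sound (S := I.sys)
    (fun D hD => ((I.mem_minList D).1 hD).1) h.1
  refine I.compatible.crp_of_abs ⟨rfl, fun q hq => ?_⟩ h2 (CardConstraint.absSat_of_check h.2)
  have hq' : q ∉ I.init := hq
  simp [initialState, hq']

/-! ### Completeness of the verifier -/

namespace VerifierState

variable {n : ℕ} {S : TransitionCS (Fin n)} {Ds : List (Fin n × Fin n → ℕ)}

/-- A pass in which no step is selected: each `D` consumes `n + 1` bits. -/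
theorem pass_skip (Ds : List (Fin n × Fin n → ℕ)) (ok : Bool) (A : Fin n → Bool) (c : List Bool) :
    pass Ds ⟨ok, A, List.replicate (Ds.length * (n + 1)) false ++ c⟩ = ⟨ok, A, c⟩ := by
  induction Ds with
  | nil => simp [pass]
  | cons D Ds ih =>
    have : process ⟨ok, A, List.replicate ((D :: Ds).length * (n + 1)) false ++ c⟩ D =
        ⟨ok, A, List.replicate (Ds.length * (n + 1)) false ++ c⟩ := by
      have hl : List.replicate ((D :: Ds).length * (n + 1)) false =
          false :: (List.replicate n false ++ List.replicate (Ds.length * (n + 1)) false) := by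
        rw [← List.replicate_add, ← List.replicate_succ]
        congr 1
        simp only [List.length_cons]
        ring
      rw [hl]
      ext q
      · simp [process, stay]
      · simp [process, stay]
      · simp only [process, List.cons_append, List.append_assoc, List.tail_cons]
        rw [List.drop_left' (by simp)]
    rw [pass, List.foldl_cons, this]
    exact ih

theorem process_fire {D : Fin n × Fin n → ℕ} {A B R : Fin n → Bool}
    (hA : ∀ p, A p = true ↔ R p = true ∨ ∃ q, D (p, q) ≠ 0)
    (hB : ∀ q, B q = true ↔ R q = true ∨ ∃ p, D (p, q) ≠ 0) (c : List Bool) :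
    process ⟨true, A, true :: (List.ofFn R ++ c)⟩ D = ⟨true, B, c⟩ := by
  have hR : stay true A (List.ofFn R ++ c) = R := by
    funext p
    simp [stay, List.getD_eq_getElem?_getD, List.getElem?_append]
  ext q
  · simp only [process, List.headD_cons, List.tail_cons, hR]
    simp only [Bool.true_and, List.all_eq_true, List.mem_finRange, forall_const, beq_iff_eq]
    intro p
    rw [Bool.eq_iff_iff, hA]
    simp
  · simp only [process, List.headD_cons, List.tail_cons, hR]
    rw [Bool.eq_iff_iff, hB]
    simp
  · simp [process]

/-- A pass in which only `D` is selected. -/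
theorem pass_fire {D : Fin n × Fin n → ℕ} (hD : D ∈ Ds) {A B R : Fin n → Bool}
    (hA : ∀ p, A p = true ↔ R p = true ∨ ∃ q, D (p, q) ≠ 0)
    (hB : ∀ q, B q = true ↔ R q = true ∨ ∃ p, D (p, q) ≠ 0) :
    ∃ r : List Bool, r.length = Ds.length * (n + 1) ∧
      ∀ c, pass Ds ⟨true, A, r ++ c⟩ = ⟨true, B, c⟩ := by
  obtain ⟨l₁, l₂, rfl⟩ := List.append_of_mem hD
  refine ⟨List.replicate (l₁.length * (n + 1)) false ++
    (true :: (List.ofFn R ++ List.replicate (l₂.length * (n + 1)) false)), ?_, fun c => ?_⟩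
  · simp
    ring
  · have h1 := pass_skip l₁ true A
      (true :: (List.ofFn R ++ (List.replicate (l₂.length * (n + 1)) false ++ c)))
    rw [pass] at h1 ⊢
    rw [List.foldl_append, List.foldl_cons]
    simp only [List.append_assoc, List.cons_append]
    rw [h1, process_fire hA hB]
    exact pass_skip l₂ true B c

/-- A path with `k` steps is followed in `k + 1` passes: one for each step, and an idle last one. -/
theorem passes_complete (hDs : ∀ D ∈ S.minSteps, D ∈ Ds) {k : ℕ} {ρ : ℕ → AbsConfig Unit (Fin n)}
    (hρ : ∀ i < k, S.toCounterSystem.AbsStep (ρ i) (ρ (i + 1))) :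
    ∃ r : List Bool, r.length = (k + 1) * (Ds.length * (n + 1) + 1) ∧
      ∀ c f, k + 1 ≤ f → passes Ds f ⟨true, (ρ 0).2, r ++ c⟩ = ⟨true, (ρ k).2, c⟩ := by
  induction k generalizing ρ with
  | zero =>
    refine ⟨List.replicate (Ds.length * (n + 1)) false ++ [false], by simp, fun c f hf => ?_⟩
    obtain ⟨f, rfl⟩ := Nat.exists_eq_add_of_le' hf
    rw [List.append_assoc, passes, pass_skip]
    simp
  | succ k ih =>
    obtain ⟨r', hr', h'⟩ := ih (ρ := fun i => ρ (i + 1)) fun i hi => hρ (i + 1) (by omega)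
    obtain ⟨D, hD, R, hA, hB⟩ := TransitionCS.exists_stay_of_absStep (hρ 0 (by omega))
    obtain ⟨r, hr, h⟩ := pass_fire (hDs D hD) hA hB
    refine ⟨r ++ (true :: r'), ?_, fun c f hf => ?_⟩
    · simp only [List.length_append, List.length_cons, hr, hr']
      ring
    · obtain ⟨f, rfl⟩ := Nat.exists_eq_add_of_le' (show 1 ≤ f by omega)
      rw [List.append_assoc, List.cons_append, passes, h]
      simpa using h' c f (by omega)

end VerifierState

/-- There is a certificate that chooses a true disjunct wherever the formula has to hold. -/
theorem CardConstraint.exists_check {n : ℕ} {A : Fin n → Bool} (φ : CardConstraint (Fin n))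
    (m : Bool) (h : m = true → φ.abs.AbsSat A) :
    ∃ r : List Bool, r.length ≤ φ.encode.length ∧ ∀ c, φ.check A m (r ++ c) = (true, c) := by
  unfold AbsSat at h
  induction φ generalizing m with
  | geq q a =>
    refine ⟨[], by simp, fun c => ?_⟩
    cases m
    · simp [check]
    · have h1 := h rfl
      simp only [abs, Sat] at h1
      cases hq : A q
      · rw [hq] at h1
        simp only [Bool.toNat_false] at h1
        have : a = 0 := by omega
        simp [check, this]
      · simp [check, hq]
  | eqZero q =>
    refine ⟨[], by simp, fun c => ?_⟩
    cases m
    · simp [check]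
    · have h1 := h rfl
      simp only [abs, Sat] at h1
      simpa [check] using h1
  | and φ ψ ih1 ih2 =>
    obtain ⟨r1, l1, h1⟩ := ih1 m fun hm => (h hm).1
    obtain ⟨r2, l2, h2⟩ := ih2 m fun hm => (h hm).2
    refine ⟨r1 ++ r2, ?_, fun c => by simp [check, h1, h2]⟩
    simp only [encode, List.length_append, List.length_cons]
    omega
  | or φ ψ ih1 ih2 =>
    obtain ⟨b, hb1, hb2⟩ : ∃ b : Bool, (m = true → b = true → φ.abs.AbsSat A) ∧
        (m = true → b = false → ψ.abs.AbsSat A) := by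
      by_cases hφ : φ.abs.AbsSat A
      · exact ⟨true, fun _ _ => hφ, by simp⟩
      · refine ⟨false, by simp, fun hm _ => ?_⟩
        exact (h hm).resolve_left hφ
    obtain ⟨r1, l1, h1⟩ := ih1 (m && b) fun hm => by
      rw [Bool.and_eq_true] at hm
      exact hb1 hm.1 hm.2
    obtain ⟨r2, l2, h2⟩ := ih2 (m && !b) fun hm => by
      rw [Bool.and_eq_true, Bool.not_eq_true'] at hm
      exact hb2 hm.1 hm.2
    refine ⟨b :: (r1 ++ r2), ?_, fun c => by simp [check, h1, h2]⟩
    simp only [encode, List.length_append, List.length_cons]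
    omega

theorem CRPInstance.exists_accepts {I : CRPInstance} (h : I.Holds) :
    ∃ c : List Bool, c.length ≤ I.n + (2 * I.n + 1) * (I.minList.length * (I.n + 1) + 1) +
      I.constraint.encode.length ∧ accepts (I, c) = true := by
  obtain ⟨k₁, k₂, ρ, h1, h2, h3, h4⟩ := (I.sys.normalized_runs I.compatible I.init I.constraint).1.1 h
  rw [Fintype.card_fin] at h2
  obtain ⟨r, hr, hpass⟩ := VerifierState.passes_complete
    (fun D hD => (I.mem_minList D).2 hD) h1.step
  obtain ⟨r', hr', hcheck⟩ := I.constraint.exists_check true fun _ => h4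
  -- the machine loads the initial configuration from the last user state to the first
  have hstart : I.initialState ((List.ofFn (ρ 0).2).reverse ++ (r ++ r')) =
      ⟨true, (ρ 0).2, r ++ r'⟩ := by
    ext p
    · rfl
    · have hp := p.2
      have hlt : I.n - 1 - p < I.n := by omega
      have hidx : I.n - 1 - (I.n - 1 - p) = (p : ℕ) := by omega
      have hinit : (ρ 0).2 p = true → p ∈ I.init := fun h5 => by
        by_contra h6
        have := h3.2 p h6
        simp [h5] at this
      simp only [initialState, List.getD_eq_getElem?_getD]
      rw [List.getElem?_append_left (by simpa using hlt), List.getElem?_reverse (by simpa using hlt)]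
      simp only [List.length_ofFn, hidx, List.getElem?_ofFn, hp, dif_pos, Option.getD_some,
        Fin.eta]
      cases h5 : (ρ 0).2 p
      · simp
      · simp [hinit h5]
    · simp [initialState]
  refine ⟨(List.ofFn (ρ 0).2).reverse ++ (r ++ r'), ?_, ?_⟩
  · simp only [List.length_append, List.length_reverse, List.length_ofFn, hr]
    have : (k₁ + k₂ + 1) * (I.minList.length * (I.n + 1) + 1) ≤
        (2 * I.n + 1) * (I.minList.length * (I.n + 1) + 1) := by gcongr
    omega
  · have hfuel : k₁ + k₂ + 1 ≤ ((List.ofFn (ρ 0).2).reverse ++ (r ++ r')).length + 1 := by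
      simp only [List.length_append, hr]
      have := Nat.le_mul_of_pos_right (k₁ + k₂ + 1)
        (show 0 < I.minList.length * (I.n + 1) + 1 by omega)
      omega
    have hc := hcheck []
    rw [List.append_nil] at hc
    simp only [accepts, finalState]
    rw [hstart, hpass r' _ hfuel]
    simp [hc]

/-! ### A Turing machine for the verifier: the program -/

namespace Verifier

/-- The stacks of the machine. -/
inductive Stack where
  | inp | done | todo | vec | aux | rows | modes | out
  deriving DecidableEq

instance : Fintype Stack :=
  ⟨{.inp, .done, .todo, .vec, .aux, .rows, .modes, .out}, fun k => by cases k <;> decide⟩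

/-- The stack alphabets: `inp` holds the unread part of the input, `todo` and `done` the unread and
the read part of the list of steps and the constraint, `vec` a vector with one bit for each user state, `aux` and
`rows` vectors of pairs, `modes` the flags of the pending subformulas, and `out` the output. -/
def Symbol : Stack → Type
  | .inp => Letter ⊕ Bool
  | .done => Letter
  | .todo => Letter
  | .vec => Bool
  | .aux => Bool × Bool
  | .rows => Bool × Bool
  | .modes => Bool
  | .out => Bool

set_option synthInstance.maxSize 4000 in
set_option synthInstance.maxHeartbeats 400000 in
/-- The labels of the program; their parameters are the variables that outlive a transition. -/
inductive Label where
  | readSize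
  | readInit
  | readRest
  | rewind (ok : Bool)
  | load (ok : Bool)
  | head (ok : Bool)
  | mark (ok sel : Bool)
  | unmark (ok sel : Bool)
  | row (ok sel : Bool)
  | entry (ok sel a r pre e : Bool)
  | restore (ok sel a r pre : Bool)
  | formula (ok : Bool)
  | seek (ok m lower : Bool)
  | unseek (ok m lower v : Bool)
  | bound (ok m v e : Bool)
  | clean (ok : Bool)
  deriving Fintype

noncomputable instance : Fintype Letter :=
  Fintype.ofInjective
    (fun l : Letter => match l with
      | .bit false => (0 : Fin 8)
      | .bit true => 1
      | .comma => 2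
      | .semi => 3
      | .geq => 4
      | .eqZero => 5
      | .and => 6
      | .or => 7)
    (by
      intro a b h
      rcases a with (_ | _) | _ | _ | _ | _ | _ | _ <;>
        rcases b with (_ | _) | _ | _ | _ | _ | _ | _ <;> first | rfl | (simp at h))

/-- The symbols read in the current transition; `none` stands for an empty stack. The accessors below
return dummy values for symbols that do not occur where they are used. -/
structure Buffer where
  inp : Option (Letter ⊕ Bool)
  letter : Option Letter
  bit : Option Bool
  pair : Option (Bool × Bool)

noncomputable instance : Fintype Buffer :=
  Fintype.ofInjective
    (fun v : Buffer => (v.inp, v.letter, v.bit, v.pair))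
    (by
      rintro ⟨⟩ ⟨⟩ h
      simpa using h)

namespace Buffer

/-- The buffer before anything is read. -/
def empty : Buffer := ⟨none, none, none, none⟩

/-- The bit of the certificate that has been read; `false` at the end of the certificate. -/
def cert (v : Buffer) : Bool :=
  match v.inp with
  | some (.inr b) => b
  | _ => false

/-- The bit of the encoded instance that has been read. -/
def instBit (v : Buffer) : Bool :=
  match v.inp with
  | some (.inl (.bit b)) => b
  | _ => false

def isInst (v : Buffer) : Bool :=
  match v.inp with
  | some (.inl _) => true
  | _ => false

def instLetter (v : Buffer) : Letter :=
  match v.inp with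
  | some (.inl l) => l
  | _ => .comma

def getLetter (v : Buffer) : Letter := v.letter.getD .comma

def getBit (v : Buffer) : Bool := v.bit.getD false

def getPair (v : Buffer) : Bool × Bool := v.pair.getD (false, false)

def isComma (v : Buffer) : Bool :=
  match v.letter with
  | some .comma => true
  | _ => false

def isGeq (v : Buffer) : Bool :=
  match v.letter with
  | some .geq => true
  | _ => false

def isAnd (v : Buffer) : Bool :=
  match v.letter with
  | some .and => true
  | _ => false

def isOr (v : Buffer) : Bool :=
  match v.letter with
  | some .or => true
  | _ => false

end Buffer

/-- The letters that occur in the encoding of a multiset of transitions. -/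
def isStepLetter : Letter → Bool
  | .bit _ => true
  | .comma => true
  | .semi => true
  | _ => false

/-- The statements of the programming language of the machine. -/
abbrev Code := TM2.Stmt Symbol Label Buffer

abbrev popInp : Code → Code := TM2.Stmt.pop .inp fun v x => { v with inp := x }
abbrev popTodo : Code → Code := TM2.Stmt.pop .todo fun v x => { v with letter := x }
abbrev popDone : Code → Code := TM2.Stmt.pop .done fun v x => { v with letter := x }
abbrev popVec : Code → Code := TM2.Stmt.pop .vec fun v x => { v with bit := x }
abbrev popModes : Code → Code := TM2.Stmt.pop .modes fun v x => { v with bit := x }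
abbrev popAux : Code → Code := TM2.Stmt.pop .aux fun v x => { v with pair := x }
abbrev popRows : Code → Code := TM2.Stmt.pop .rows fun v x => { v with pair := x }

open TM2.Stmt in
/-- The program. `readSize`, `readInit`, `readRest` split the encoded instance, so that only the
certificate is left in `inp`; `rewind` moves the list of steps back to `todo`, and `load` computes the
initial configuration from the certificate; before a later pass it has nothing to do, as `aux` is
empty then. At `head`, a new multiset of transitions or the end of the list has been
reached. `mark` and `unmark` read the states that stay occupied, `row`, `entry` and `restore` compare
the matrix with the current configuration and compute the next one. `formula` reads the next
subformula, `seek`, `unseek` and `bound` evaluate an atom, and `clean` empties the stacks. -/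
def program : Label → Code
  | .readSize => popInp <|
      branch Buffer.instBit
        (push .rows (fun _ => (false, false)) <| goto fun _ => .readSize)
        (goto fun _ => .readInit)
  | .readInit => popRows <|
      branch (fun v => v.pair.isSome)
        (popInp <| push .aux (fun v => (v.instBit, v.instBit)) <| goto fun _ => .readInit)
        (goto fun _ => .readRest)
  | .readRest => peek .inp (fun v x => { v with inp := x }) <|
      branch Buffer.isInst
        (popInp <| push .done Buffer.instLetter <| goto fun _ => .readRest)
        (goto fun _ => .rewind true)
  | .rewind ok => popDone <|
      branch (fun v => v.letter.isSome)
        (push .todo Buffer.getLetter <| goto fun _ => .rewind ok)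
        (goto fun _ => .load ok)
  | .load ok => popAux <|
      branch (fun v => v.pair.isSome)
        (popInp <| push .vec (fun v => v.getPair.1 && v.cert) <| goto fun _ => .load ok)
        (goto fun _ => .head ok)
  | .head ok => peek .todo (fun v x => { v with letter := x }) <| popInp <|
      branch (fun v => v.letter.elim false isStepLetter)
        (goto fun v => .mark ok v.cert)
        (branch Buffer.cert
          (goto fun _ => .rewind ok)
          (push .modes (fun _ => true) <| goto fun _ => .formula ok))
  | .mark ok sel => popVec <|
      branch (fun v => v.bit.isSome)
        (popInp <| push .aux (fun v => (v.getBit, if sel then v.cert else v.getBit)) <|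
          goto fun _ => .mark ok sel)
        (goto fun _ => .unmark ok sel)
  | .unmark ok sel => popAux <|
      branch (fun v => v.pair.isSome)
        (push .rows Buffer.getPair <| push .vec (fun v => v.getPair.2) <|
          goto fun _ => .unmark ok sel)
        (goto fun _ => .row ok sel)
  | .row ok sel => popRows <|
      branch (fun v => v.pair.isSome)
        (goto fun v => .entry ok sel v.getPair.1 v.getPair.2 false false)
        (popTodo <| push .done Buffer.getLetter <| goto fun _ => .head ok)
  | .entry ok sel a r pre e => popTodo <| push .done Buffer.getLetter <|
      branch Buffer.isComma
        (popVec <| push .aux (fun v => (v.getBit || (sel && e), false)) <|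
          peek .vec (fun v x => { v with bit := x }) <|
          branch (fun v => v.bit.isSome)
            (goto fun _ => .entry ok sel a r (pre || (sel && e)) false)
            (goto fun _ => .restore ok sel a r (pre || (sel && e))))
        (goto fun _ => .entry ok sel a r pre true)
  | .restore ok sel a r pre => popAux <|
      branch (fun v => v.pair.isSome)
        (push .vec (fun v => v.getPair.1) <| goto fun _ => .restore ok sel a r pre)
        (goto fun _ => .row (ok && (a == (r || pre))) sel)
  | .formula ok => popModes <|
      branch (fun v => v.bit.isSome)
        (popTodo <|
          branch Buffer.isAnd
            (push .modes Buffer.getBit <| push .modes Buffer.getBit <| goto fun _ => .formula ok)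
            (branch Buffer.isOr
              (popInp <| push .modes (fun v => v.getBit && !v.cert) <|
                push .modes (fun v => v.getBit && v.cert) <| goto fun _ => .formula ok)
              (goto fun v => .seek ok v.getBit v.isGeq)))
        (goto fun _ => .clean ok)
  | .seek ok m lower => popTodo <|
      branch Buffer.isComma
        (peek .vec (fun v x => { v with bit := x }) <| goto fun v => .unseek ok m lower v.getBit)
        (popVec <| push .aux (fun v => (v.getBit, false)) <| goto fun _ => .seek ok m lower)
  | .unseek ok m lower x => popAux <|
      branch (fun v => v.pair.isSome)
        (push .vec (fun v => v.getPair.1) <| goto fun _ => .unseek ok m lower x)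
        (goto fun _ => if lower then .bound ok m x false else .formula (ok && (!m || !x)))
  | .bound ok m x e => popTodo <|
      branch Buffer.isComma
        (goto fun _ => .formula (ok && (!m || !e || x)))
        (goto fun _ => .bound ok m x true)
  | .clean ok => popInp <| popDone <| popVec <|
      branch (fun v => v.inp.isSome || v.letter.isSome || v.bit.isSome)
        (goto fun _ => .clean ok)
        (push .out (fun _ => ok) <| TM2.Stmt.load (fun _ => Buffer.empty) halt)

/-- The Turing machine that runs the program. -/
noncomputable def machine : FinTM2 :=
  haveI : Fintype (Symbol .inp) := inferInstanceAs (Fintype (Letter ⊕ Bool))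
  { K := Stack
    k₀ := .inp
    k₁ := .out
    Γ := Symbol
    Λ := Label
    main := .readSize
    σ := Buffer
    initialState := Buffer.empty
    m := program }

/-! ### Configurations and runs of the machine -/

/-- The contents of the stacks, the top symbols first. -/
structure Stacks where
  inp : List (Letter ⊕ Bool)
  done : List Letter
  todo : List Letter
  vec : List Bool
  aux : List (Bool × Bool)
  rows : List (Bool × Bool)
  modes : List Bool
  out : List Bool

namespace Stacks

/-- The content of a stack. -/
def get (S : Stacks) : (k : Stack) → List (Symbol k)
  | .inp => S.inp
  | .done => S.done
  | .todo => S.todo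
  | .vec => S.vec
  | .aux => S.aux
  | .rows => S.rows
  | .modes => S.modes
  | .out => S.out

/-- Replace the content of a stack. -/
def set (S : Stacks) : (k : Stack) → List (Symbol k) → Stacks
  | .inp, l => { S with inp := l }
  | .done, l => { S with done := l }
  | .todo, l => { S with todo := l }
  | .vec, l => { S with vec := l }
  | .aux, l => { S with aux := l }
  | .rows, l => { S with rows := l }
  | .modes, l => { S with modes := l }
  | .out, l => { S with out := l }

theorem get_set (S : Stacks) (k : Stack) (l : List (Symbol k)) :
    (S.set k l).get = Function.update S.get k l := by
  funext k'
  cases k <;> cases k' <;> rfl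

end Stacks

/-- The effect of a statement, computed on `Stacks`. -/
def exec : Code → Buffer → Stacks → Option Label × Buffer × Stacks
  | .push k f q, v, S => exec q v (S.set k (f v :: S.get k))
  | .peek k f q, v, S => exec q (f v (S.get k).head?) S
  | .pop k f q, v, S => exec q (f v (S.get k).head?) (S.set k (S.get k).tail)
  | .load f q, v, S => exec q (f v) S
  | .branch f q₁ q₂, v, S => cond (f v) (exec q₁ v S) (exec q₂ v S)
  | .goto f, v, S => (some (f v), v, S)
  | .halt, v, S => (none, v, S)

/-- The configuration of the machine with the given label, buffer and stacks. -/
def cfg (x : Option Label × Buffer × Stacks) : machine.Cfg :=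
  TM2.Cfg.mk (Γ := Symbol) (Λ := Label) (σ := Buffer) x.1 x.2.1 x.2.2.get

theorem stepAux_eq_exec (q : Code) (v : Buffer) (S : Stacks) :
    TM2.stepAux q v S.get = cfg (exec q v S) := by
  induction q generalizing v S with
  | push k f q ih => rw [TM2.stepAux, exec, ← ih, Stacks.get_set]
  | peek k f q ih => rw [TM2.stepAux, exec, ← ih]
  | pop k f q ih => rw [TM2.stepAux, exec, ← ih, Stacks.get_set]
  | load f q ih => rw [TM2.stepAux, exec, ← ih]
  | branch f q₁ q₂ ih₁ ih₂ =>
    rw [TM2.stepAux, exec]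
    cases f v
    · exact ih₂ v S
    · exact ih₁ v S
  | goto f => rfl
  | halt => rfl

theorem step_cfg (l : Label) (v : Buffer) (S : Stacks) :
    machine.step (cfg (some l, v, S)) = some (cfg (exec (program l) v S)) :=
  congrArg some (stepAux_eq_exec (program l) v S)

/-- Whatever the buffer holds, the machine gets from `a` to `b` in at most `t` steps. -/
def Runs (t : ℕ) (a b : Label × Stacks) : Prop :=
  ∀ v, ∃ v', Nonempty (StateTransition.EvalsToInTime machine.step (cfg (some a.1, v, a.2))
    (some (cfg (some b.1, v', b.2))) t)

theorem Runs.refl (a : Label × Stacks) : Runs 0 a a :=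
  fun v => ⟨v, ⟨.refl _ _⟩⟩

theorem Runs.trans {s t u : ℕ} {a b c : Label × Stacks} (h₁ : Runs s a b) (h₂ : Runs t b c)
    (h : s + t ≤ u) : Runs u a c := by
  intro v
  obtain ⟨v', ⟨e₁⟩⟩ := h₁ v
  obtain ⟨v'', ⟨e₂⟩⟩ := h₂ v'
  have e := StateTransition.EvalsToInTime.trans _ _ _ _ _ _ e₁ e₂
  exact ⟨v'', ⟨⟨e.toEvalsTo, e.steps_le_m.trans (by omega)⟩⟩⟩

theorem Runs.mono {s t : ℕ} {a b : Label × Stacks} (h₁ : Runs s a b) (h : s ≤ t) : Runs t a b :=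
  h₁.trans (.refl b) h

theorem Runs.of_exec {l l' : Label} {S S' : Stacks}
    (h : ∀ v, ∃ v', exec (program l) v S = (some l', v', S')) : Runs 1 (l, S) (l', S') := by
  intro v
  obtain ⟨v', h⟩ := h v
  exact ⟨v', ⟨⟨⟨1, (step_cfg l v S).trans (congrArg (fun x => some (cfg x)) h)⟩, le_rfl⟩⟩⟩

/-! ### The loops of the program -/

section Loops

variable {i : List (Letter ⊕ Bool)} {c : List Bool} {d t : List Letter} {v m o : List Bool}
  {x w : List (Bool × Bool)} {ok sel : Bool}

theorem runs_readSize (k : ℕ) :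
    Runs (k + 1) (.readSize, ⟨(encUnary k).map Sum.inl ++ i, d, t, v, x, w, m, o⟩)
      (.readInit, ⟨i, d, t, v, x, List.replicate k (false, false) ++ w, m, o⟩) := by
  induction k generalizing w with
  | zero => exact .of_exec fun v => ⟨_, rfl⟩
  | succ k ih =>
    have h : Runs 1 (.readSize, ⟨(encUnary (k + 1)).map Sum.inl ++ i, d, t, v, x, w, m, o⟩)
        (.readSize, ⟨(encUnary k).map Sum.inl ++ i, d, t, v, x, (false, false) :: w, m, o⟩) :=
      .of_exec fun v => ⟨_, rfl⟩
    rw [List.replicate_succ', List.append_assoc]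
    exact h.trans ih (by omega)

theorem runs_readInit (bs : List Bool) :
    Runs (bs.length + 1)
      (.readInit, ⟨bs.map (fun b => Sum.inl (Letter.bit b)) ++ i, d, t, v, x,
        List.replicate bs.length (false, false), m, o⟩)
      (.readRest, ⟨i, d, t, v, (bs.map fun b => (b, b)).reverse ++ x, [], m, o⟩) := by
  induction bs generalizing x with
  | nil => exact .of_exec fun v => ⟨_, rfl⟩
  | cons b bs ih =>
    have h : Runs 1 (.readInit, ⟨(b :: bs).map (fun b => Sum.inl (Letter.bit b)) ++ i, d, t, v, x,
        List.replicate (b :: bs).length (false, false), m, o⟩)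
        (.readInit, ⟨bs.map (fun b => Sum.inl (Letter.bit b)) ++ i, d, t, v, (b, b) :: x,
        List.replicate bs.length (false, false), m, o⟩) := .of_exec fun v => ⟨_, rfl⟩
    simpa using h.trans ih (u := bs.length + 1 + 1) (by omega)

theorem runs_readRest (z : List Letter) :
    Runs (z.length + 1) (.readRest, ⟨z.map Sum.inl ++ c.map Sum.inr, d, t, v, x, w, m, o⟩)
      (.rewind true, ⟨c.map Sum.inr, z.reverse ++ d, t, v, x, w, m, o⟩) := by
  induction z generalizing d with
  | nil =>
    cases c
    · exact .of_exec fun v => ⟨_, rfl⟩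
    · exact .of_exec fun v => ⟨_, rfl⟩
  | cons l z ih =>
    have h : Runs 1 (.readRest, ⟨(l :: z).map Sum.inl ++ c.map Sum.inr, d, t, v, x, w, m, o⟩)
        (.readRest, ⟨z.map Sum.inl ++ c.map Sum.inr, l :: d, t, v, x, w, m, o⟩) :=
      .of_exec fun v => ⟨_, rfl⟩
    simpa using h.trans ih (u := z.length + 1 + 1) (by omega)

theorem runs_rewind (z : List Letter) :
    Runs (z.length + 1) (.rewind ok, ⟨i, z, t, v, x, w, m, o⟩)
      (.load ok, ⟨i, [], z.reverse ++ t, v, x, w, m, o⟩) := by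
  induction z generalizing t with
  | nil => exact .of_exec fun v => ⟨_, rfl⟩
  | cons l z ih =>
    have h : Runs 1 (.rewind ok, ⟨i, l :: z, t, v, x, w, m, o⟩)
        (.rewind ok, ⟨i, z, l :: t, v, x, w, m, o⟩) := .of_exec fun v => ⟨_, rfl⟩
    simpa using h.trans ih (u := z.length + 1 + 1) (by omega)

/-- Combine a list with the bits of the certificate. -/
def withCert {α β : Type*} (f : α → Bool → β) : List α → List Bool → List β
  | [], _ => []
  | a :: l, c => f a (c.headD false) :: withCert f l c.tail

theorem length_withCert {α β : Type*} (f : α → Bool → β) (l : List α) (c : List Bool) :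
    (withCert f l c).length = l.length := by
  induction l generalizing c with
  | nil => rfl
  | cons a l ih => simp [withCert, ih]

theorem getElem_withCert {α β : Type*} (f : α → Bool → β) (l : List α) (c : List Bool) (k : ℕ)
    (h : k < (withCert f l c).length) :
    (withCert f l c)[k] =
      f (l[k]'(by rwa [length_withCert] at h)) (c.getD k false) := by
  induction l generalizing c k with
  | nil => simp [withCert] at h
  | cons a l ih =>
    cases k with
    | zero => cases c <;> simp [withCert]
    | succ k =>
      simp only [withCert, List.getElem_cons_succ]
      rw [ih]
      cases c <;> simp

theorem runs_load (l : List (Bool × Bool)) :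
    Runs (l.length + 1) (.load ok, ⟨c.map Sum.inr, d, t, v, l, w, m, o⟩)
      (.head ok, ⟨(c.drop l.length).map Sum.inr, d, t,
        (withCert (fun p b => p.1 && b) l c).reverse ++ v, [], w, m, o⟩) := by
  induction l generalizing c v with
  | nil => exact .of_exec fun v => ⟨_, rfl⟩
  | cons p l ih =>
    have h : Runs 1 (.load ok, ⟨c.map Sum.inr, d, t, v, p :: l, w, m, o⟩)
        (.load ok, ⟨c.tail.map Sum.inr, d, t, (p.1 && c.headD false) :: v, l, w, m, o⟩) := by
      cases c
      · exact .of_exec fun v => ⟨_, rfl⟩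
      · exact .of_exec fun v => ⟨_, rfl⟩
    simpa [withCert] using h.trans ih (u := l.length + 1 + 1) (by omega)

theorem runs_mark (l : List Bool) :
    Runs (l.length + 1) (.mark ok sel, ⟨c.map Sum.inr, d, t, l, x, w, m, o⟩)
      (.unmark ok sel, ⟨(c.drop l.length).map Sum.inr, d, t, [],
        (withCert (fun a b => (a, if sel then b else a)) l c).reverse ++ x, w, m, o⟩) := by
  induction l generalizing c x with
  | nil => exact .of_exec fun v => ⟨_, rfl⟩
  | cons a l ih =>
    have h : Runs 1 (.mark ok sel, ⟨c.map Sum.inr, d, t, a :: l, x, w, m, o⟩)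
        (.mark ok sel, ⟨c.tail.map Sum.inr, d, t, l,
          (a, if sel then c.headD false else a) :: x, w, m, o⟩) := by
      cases c
      · exact .of_exec fun v => ⟨_, rfl⟩
      · exact .of_exec fun v => ⟨_, rfl⟩
    simpa [withCert] using h.trans ih (u := l.length + 1 + 1) (by omega)

theorem runs_unmark (l : List (Bool × Bool)) :
    Runs (l.length + 1) (.unmark ok sel, ⟨i, d, t, v, l, w, m, o⟩)
      (.row ok sel, ⟨i, d, t, (l.map Prod.snd).reverse ++ v, [], l.reverse ++ w, m, o⟩) := by
  induction l generalizing v w with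
  | nil => exact .of_exec fun v => ⟨_, rfl⟩
  | cons p l ih =>
    have h : Runs 1 (.unmark ok sel, ⟨i, d, t, v, p :: l, w, m, o⟩)
        (.unmark ok sel, ⟨i, d, t, p.2 :: v, l, p :: w, m, o⟩) := .of_exec fun v => ⟨_, rfl⟩
    simpa using h.trans ih (u := l.length + 1 + 1) (by omega)

theorem runs_restore {a r pre : Bool} (l : List (Bool × Bool)) :
    Runs (l.length + 1) (.restore ok sel a r pre, ⟨i, d, t, v, l, w, m, o⟩)
      (.row (ok && (a == (r || pre))) sel,
        ⟨i, d, t, (l.map Prod.fst).reverse ++ v, [], w, m, o⟩) := by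
  induction l generalizing v with
  | nil => exact .of_exec fun v => ⟨_, rfl⟩
  | cons p l ih =>
    have h : Runs 1 (.restore ok sel a r pre, ⟨i, d, t, v, p :: l, w, m, o⟩)
        (.restore ok sel a r pre, ⟨i, d, t, p.1 :: v, l, w, m, o⟩) := .of_exec fun v => ⟨_, rfl⟩
    simpa using h.trans ih (u := l.length + 1 + 1) (by omega)

theorem encodeNat_eq_nil {k : ℕ} : encodeNat k = [] ↔ k = 0 := by
  refine ⟨fun h => ?_, fun h => h ▸ rfl⟩
  rw [← decode_encodeNat k, h]
  rfl

theorem runs_entry_bits {a r pre e : Bool} (bs : List Bool) :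
    Runs bs.length (.entry ok sel a r pre e, ⟨i, d, bs.map Letter.bit ++ t, v, x, w, m, o⟩)
      (.entry ok sel a r pre (e || decide (bs ≠ [])),
        ⟨i, (bs.map Letter.bit).reverse ++ d, t, v, x, w, m, o⟩) := by
  induction bs generalizing d e with
  | nil => simpa using Runs.refl _
  | cons b bs ih =>
    have h : Runs 1
        (.entry ok sel a r pre e, ⟨i, d, (b :: bs).map Letter.bit ++ t, v, x, w, m, o⟩)
        (.entry ok sel a r pre true,
          ⟨i, Letter.bit b :: d, bs.map Letter.bit ++ t, v, x, w, m, o⟩) :=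
      .of_exec fun v => ⟨_, rfl⟩
    simpa using h.trans ih (u := bs.length + 1) (by omega)

theorem runs_entry_comma {a r pre e b : Bool} :
    Runs 1 (.entry ok sel a r pre e, ⟨i, d, Letter.comma :: t, b :: v, x, w, m, o⟩)
      (if v = [] then .restore ok sel a r (pre || (sel && e))
        else .entry ok sel a r (pre || (sel && e)) false,
        ⟨i, Letter.comma :: d, t, v, (b || (sel && e), false) :: x, w, m, o⟩) := by
  cases v
  · exact .of_exec fun v => ⟨_, rfl⟩
  · exact .of_exec fun v => ⟨_, rfl⟩

theorem runs_entry {a r pre b : Bool} (k : ℕ) :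
    Runs (encBinary k).length
      (.entry ok sel a r pre false, ⟨i, d, encBinary k ++ t, b :: v, x, w, m, o⟩)
      (if v = [] then .restore ok sel a r (pre || (sel && decide (k ≠ 0)))
        else .entry ok sel a r (pre || (sel && decide (k ≠ 0))) false,
        ⟨i, (encBinary k).reverse ++ d, t, v, (b || (sel && decide (k ≠ 0)), false) :: x,
          w, m, o⟩) := by
  have h := (runs_entry_bits (i := i) (d := d) (t := Letter.comma :: t) (v := b :: v) (x := x)
    (w := w) (m := m) (o := o) (ok := ok) (sel := sel) (a := a) (r := r) (pre := pre) (e := false)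
    (encodeNat k)).trans runs_entry_comma le_rfl
  simpa [encBinary, encodeNat_eq_nil] using h

/-- A nonempty row of a matrix is read: its entries are the first components of the list, the
second components are the current vector. -/
theorem runs_entries {a r pre : Bool} (y : ℕ × Bool) (ys : List (ℕ × Bool)) :
    Runs ((y :: ys).flatMap fun z => encBinary z.1).length
      (.entry ok sel a r pre false,
        ⟨i, d, ((y :: ys).flatMap fun z => encBinary z.1) ++ t, (y :: ys).map Prod.snd,
          x, w, m, o⟩)
      (.restore ok sel a r (pre || (y :: ys).any fun z => sel && decide (z.1 ≠ 0)),
        ⟨i, ((y :: ys).flatMap fun z => encBinary z.1).reverse ++ d, t, [],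
          ((y :: ys).map fun z => (z.2 || (sel && decide (z.1 ≠ 0)), false)).reverse ++ x,
          w, m, o⟩) := by
  induction ys generalizing y d x pre with
  | nil => simpa using runs_entry (v := []) (b := y.2) y.1
  | cons y' ys ih =>
    have h := (runs_entry (i := i) (d := d) (v := (y' :: ys).map Prod.snd) (x := x) (w := w)
      (m := m) (o := o) (ok := ok) (sel := sel) (a := a) (r := r) (pre := pre) (b := y.2)
      (t := ((y' :: ys).flatMap fun z => encBinary z.1) ++ t) y.1)
    rw [if_neg (by simp)] at h
    have h' := h.trans (ih y') le_rfl
    simpa [Bool.or_assoc] using h'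

end Loops

end Verifier

/-! ### The certificate only gets shorter -/

theorem VerifierState.length_cert_pass_le {n : ℕ} (Ds : List (Fin n × Fin n → ℕ))
    (s : VerifierState n) : (pass Ds s).cert.length ≤ s.cert.length := by
  induction Ds generalizing s with
  | nil => rfl
  | cons D Ds ih =>
    refine (ih (s.process D)).trans ?_
    simp only [process, List.length_drop, List.length_tail]
    omega

theorem VerifierState.length_cert_passes_le {n : ℕ} (Ds : List (Fin n × Fin n → ℕ)) (k : ℕ)
    (s : VerifierState n) : (passes Ds k s).cert.length ≤ s.cert.length := by
  induction k generalizing s with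
  | zero => rfl
  | succ k ih =>
    have h := length_cert_pass_le Ds s
    have h' : (pass Ds s).cert.tail.length ≤ s.cert.length := by
      rw [List.length_tail]
      omega
    rw [passes]
    split_ifs
    · exact (ih _).trans h'
    · exact h'

theorem CardConstraint.length_check_le {n : ℕ} (A : Fin n → Bool) (φ : CardConstraint (Fin n))
    (m : Bool) (c : List Bool) : (φ.check A m c).2.length ≤ c.length := by
  induction φ generalizing m c with
  | geq q a => rfl
  | eqZero q => rfl
  | and φ ψ ih1 ih2 => exact (ih2 _ _).trans (ih1 _ _)
  | or φ ψ ih1 ih2 => exact (ih2 _ _).trans ((ih1 _ _).trans (by simp))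

/-! ### Runs of the machine on an encoded instance -/

namespace Verifier

variable {n : ℕ}

section Loops

variable {i : List (Letter ⊕ Bool)} {c : List Bool} {d t : List Letter} {m o : List Bool}
  {x w : List (Bool × Bool)} {ok sel : Bool}

/-- The encoding of a row of a matrix. -/
def encRow (D : Fin n × Fin n → ℕ) (p : Fin n) : List Letter :=
  (List.finRange n).flatMap fun q => encBinary (D (p, q))

theorem encStep_eq (D : Fin n × Fin n → ℕ) :
    encStep D = (List.finRange n).flatMap (encRow D) ++ [Letter.semi] := rfl

theorem length_le_length_flatMap {α β : Type*} (l : List α) (f : α → List β)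
    (h : ∀ a, 1 ≤ (f a).length) : l.length ≤ (l.flatMap f).length := by
  induction l with
  | nil => simp
  | cons a l ih =>
    have := h a
    simp only [List.length_cons, List.flatMap_cons, List.length_append]
    omega

theorem le_length_encRow (D : Fin n × Fin n → ℕ) (p : Fin n) : n ≤ (encRow D p).length := by
  simpa [encRow] using length_le_length_flatMap (List.finRange n)
    (fun q => encBinary (D (p, q))) (fun q => by simp [encBinary])

theorem runs_row (D : Fin n × Fin n → ℕ) (p : Fin n) (B : Fin n → Bool) (a r : Bool) :
    Runs (2 * (encRow D p).length + 2)
      (.row ok sel, ⟨i, d, encRow D p ++ t, (List.finRange n).map B, [], (a, r) :: w, m, o⟩)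
      (.row (ok && (a == (r || (List.finRange n).any fun q => sel && decide (D (p, q) ≠ 0)))) sel,
        ⟨i, (encRow D p).reverse ++ d, t,
          (List.finRange n).map fun q => B q || (sel && decide (D (p, q) ≠ 0)), [], w, m, o⟩) := by
  have hlen := le_length_encRow D p
  unfold encRow at *
  have hl : (List.finRange n).length = n := List.length_finRange
  generalize List.finRange n = qs at *
  cases qs with
  | nil =>
    rw [List.length_nil] at hl
    exact absurd p.2 (by omega)
  | cons q qs =>
    have h1 : Runs 1
        (.row ok sel, ⟨i, d, ((q :: qs).flatMap fun q => encBinary (D (p, q))) ++ t,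
          (q :: qs).map B, [], (a, r) :: w, m, o⟩)
        (.entry ok sel a r false false, ⟨i, d, ((q :: qs).flatMap fun q => encBinary (D (p, q))) ++ t,
          (q :: qs).map B, [], w, m, o⟩) := .of_exec fun v => ⟨_, rfl⟩
    have h2 := runs_entries (i := i) (d := d) (t := t) (x := []) (w := w) (m := m) (o := o)
      (ok := ok) (sel := sel) (a := a) (r := r) (pre := false)
      (D (p, q), B q) (qs.map fun q => (D (p, q), B q))
    rw [show (D (p, q), B q) :: qs.map (fun q => (D (p, q), B q)) =
      (q :: qs).map fun q => (D (p, q), B q) from rfl] at h2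
    simp only [List.flatMap_map, List.map_map, List.any_map, Function.comp_def,
      Bool.false_or, List.append_nil] at h2
    have h3 := runs_restore (i := i) (d := ((q :: qs).flatMap fun q => encBinary (D (p, q))).reverse
        ++ d) (t := t) (v := []) (w := w) (m := m) (o := o) (ok := ok) (sel := sel)
      (a := a) (r := r) (pre := (q :: qs).any fun q => sel && decide (D (p, q) ≠ 0))
      ((q :: qs).map fun q => (B q || (sel && decide (D (p, q) ≠ 0)), false)).reverse
    simp only [List.map_reverse, List.reverse_reverse, List.map_map, Function.comp_def,
      List.append_nil, List.length_reverse, List.length_map] at h3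
    refine (h1.trans h2 le_rfl).trans h3 ?_
    omega

theorem runs_rows (D : Fin n × Fin n → ℕ) (A R B : Fin n → Bool) (ps : List (Fin n)) :
    Runs (2 * (ps.flatMap (encRow D)).length + 2 * ps.length + 1)
      (.row ok sel, ⟨i, d, ps.flatMap (encRow D) ++ Letter.semi :: t, (List.finRange n).map B, [],
        ps.map fun p => (A p, R p), m, o⟩)
      (.head (ok && ps.all fun p =>
          A p == (R p || (List.finRange n).any fun q => sel && decide (D (p, q) ≠ 0))),
        ⟨i, (ps.flatMap (encRow D) ++ [Letter.semi]).reverse ++ d, t,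
          (List.finRange n).map fun q => B q || ps.any fun p => sel && decide (D (p, q) ≠ 0),
          [], [], m, o⟩) := by
  induction ps generalizing B d ok with
  | nil =>
    have h : Runs 1 (.row ok sel, ⟨i, d, Letter.semi :: t, (List.finRange n).map B, [], [], m, o⟩)
        (.head ok, ⟨i, Letter.semi :: d, t, (List.finRange n).map B, [], [], m, o⟩) :=
      .of_exec fun v => ⟨_, rfl⟩
    simpa using h
  | cons p ps ih =>
    have h := (runs_row (i := i) (d := d) (w := ps.map fun p => (A p, R p)) (m := m) (o := o)
      (ok := ok) (sel := sel) (t := ps.flatMap (encRow D) ++ Letter.semi :: t) D p B (A p)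
      (R p)).trans (ih _) le_rfl
    simp only [Bool.or_assoc, Bool.and_assoc] at h
    simp only [List.flatMap_cons, List.append_assoc, List.map_cons, List.all_cons, List.any_cons,
      List.reverse_append] at h ⊢
    exact h.mono (by simp only [List.length_append, List.length_cons]; omega)

/-- The machine at the start of an entry of the list of steps, in the given state of the
verifier. -/
def atHead (s : VerifierState n) (d t : List Letter) : Label × Stacks :=
  (.head s.ok, ⟨s.cert.map Sum.inr, d, t, (List.finRange n).map s.conf, [], [], [], []⟩)

theorem encStep_eq_cons (D : Fin n × Fin n → ℕ) :
    ∃ l z, isStepLetter l = true ∧ encStep D = l :: z := by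
  have hne : encStep D ≠ [] := by simp [encStep]
  obtain ⟨l, z, h⟩ := List.exists_cons_of_ne_nil hne
  refine ⟨l, z, ?_, h⟩
  have hl : l ∈ encStep D := h ▸ List.mem_cons_self
  simp only [encStep, encBinary, List.mem_append, List.mem_flatMap, List.mem_map,
    List.mem_singleton] at hl
  rcases hl with ⟨_, _, _, _, ⟨_, _, rfl⟩ | rfl⟩ | rfl <;> rfl

theorem runs_process (s : VerifierState n) (D : Fin n × Fin n → ℕ) (d t : List Letter) :
    Runs (2 * (encStep D).length + 4 * n + 2) (atHead s d (encStep D ++ t))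
      (atHead (s.process D) ((encStep D).reverse ++ d) t) := by
  obtain ⟨ok, A, c⟩ := s
  have h1 : Runs 1 (atHead ⟨ok, A, c⟩ d (encStep D ++ t))
      (.mark ok (c.headD false), ⟨c.tail.map Sum.inr, d, encStep D ++ t, (List.finRange n).map A,
        [], [], [], []⟩) := by
    obtain ⟨l, z, hl, h⟩ := encStep_eq_cons D
    rw [h]
    cases l <;> simp [isStepLetter] at hl
    all_goals
      cases c
      · exact .of_exec fun v => ⟨_, rfl⟩
      · exact .of_exec fun v => ⟨_, rfl⟩
  generalize hsel : c.headD false = sel at h1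
  have h2 := runs_mark (c := c.tail) (d := d) (t := encStep D ++ t) (x := []) (w := []) (m := [])
    (o := []) (ok := ok) (sel := sel) ((List.finRange n).map A)
  have hread : withCert (fun a b => (a, if sel then b else a)) ((List.finRange n).map A) c.tail =
      (List.finRange n).map fun p => (A p, VerifierState.stay sel A c.tail p) := by
    refine List.ext_getElem (by simp [length_withCert]) fun k h h' => ?_
    rw [getElem_withCert]
    simp [VerifierState.stay]
  rw [hread] at h2
  have h3 := runs_unmark (i := (c.tail.drop n).map Sum.inr) (d := d) (t := encStep D ++ t) (v := [])
    (w := []) (m := []) (o := []) (ok := ok) (sel := sel)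
    ((List.finRange n).map fun p => (A p, VerifierState.stay sel A c.tail p)).reverse
  simp only [List.map_reverse, List.reverse_reverse, List.map_map, Function.comp_def,
    List.append_nil, List.length_reverse, List.length_map, List.length_finRange] at h2 h3
  have h4 := runs_rows (i := (c.tail.drop n).map Sum.inr) (d := d) (t := t) (m := []) (o := [])
    (ok := ok) (sel := sel) D A (VerifierState.stay sel A c.tail)
    (VerifierState.stay sel A c.tail) (List.finRange n)
  have h := ((h1.trans h2 le_rfl).trans h3 le_rfl).trans
    (by simpa only [encStep_eq, List.append_assoc, List.cons_append, List.nil_append] using h4) le_rfl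
  subst hsel
  refine h.mono ?_
  rw [encStep_eq]
  simp only [List.length_append, List.length_cons, List.length_nil, List.length_finRange]
  omega

/-- The encoding of each `D` has at least one letter, which pays for the `4 * n + 2` steps that do not
depend on its length. -/
theorem runs_pass (Ds : List (Fin n × Fin n → ℕ)) (s : VerifierState n) (d t : List Letter) :
    Runs ((Ds.flatMap encStep).length * (4 * n + 4)) (atHead s d (Ds.flatMap encStep ++ t))
      (atHead (VerifierState.pass Ds s) ((Ds.flatMap encStep).reverse ++ d) t) := by
  induction Ds generalizing s d with
  | nil => simpa [VerifierState.pass] using Runs.refl _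
  | cons D Ds ih =>
    have h := (runs_process s D d (Ds.flatMap encStep ++ t)).trans (ih _ _) le_rfl
    simp only [List.flatMap_cons, List.append_assoc, List.reverse_append] at h ⊢
    refine h.mono ?_
    have : 1 ≤ (encStep D).length := by simp [encStep]
    simp only [List.length_append]
    nlinarith

theorem encode_eq_cons (φ : CardConstraint (Fin n)) :
    ∃ l z, isStepLetter l = false ∧ φ.encode = l :: z := by
  cases φ <;> exact ⟨_, _, rfl, rfl⟩

/-- The machine at the start of a formula. -/
def atFormula (ok : Bool) (A : Fin n → Bool) (c : List Bool) (d t : List Letter) (m : List Bool) :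
    Label × Stacks :=
  (.formula ok, ⟨c.map Sum.inr, d, t, (List.finRange n).map A, [], [], m, []⟩)

/-- The list of steps is read until the certificate does not ask for another pass; each pass but the
last consumes a bit of it, so that more fuel than bits is enough. -/
theorem runs_passes (Ds : List (Fin n × Fin n → ℕ)) (φ : CardConstraint (Fin n)) (k : ℕ)
    (s : VerifierState n) (h : s.cert.length < k) :
    Runs (k * ((Ds.flatMap encStep).length * (4 * n + 5) + 3))
      (atHead s [] (Ds.flatMap encStep ++ φ.encode))
      (atFormula (VerifierState.passes Ds k s).ok (VerifierState.passes Ds k s).conf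
        (VerifierState.passes Ds k s).cert (Ds.flatMap encStep).reverse φ.encode [true]) := by
  induction k generalizing s with
  | zero => omega
  | succ k ih =>
    have h1 := runs_pass Ds s [] φ.encode
    rw [List.append_nil] at h1
    have hlen := VerifierState.length_cert_pass_le Ds s
    rw [VerifierState.passes]
    generalize VerifierState.pass Ds s = s' at *
    obtain ⟨ok, A, c⟩ := s'
    obtain ⟨l, z, hl, hφ⟩ := encode_eq_cons φ
    cases hc : c.headD false
    · have h2 : Runs 1 (atHead ⟨ok, A, c⟩ (Ds.flatMap encStep).reverse φ.encode)
          (atFormula ok A c.tail (Ds.flatMap encStep).reverse φ.encode [true]) := by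
        rw [hφ]
        cases l <;> simp [isStepLetter] at hl
        all_goals
          rcases c with _ | ⟨_ | _, c⟩
          · exact .of_exec fun v => ⟨_, rfl⟩
          · exact .of_exec fun v => ⟨_, rfl⟩
          · exact absurd hc (by simp)
      rw [if_neg (by simp)]
      refine h1.trans h2 ?_
      nlinarith [Nat.zero_le (k * ((Ds.flatMap encStep).length * (4 * n + 5) + 3))]
    · rcases c with _ | ⟨_ | _, c⟩
      · simp at hc
      · simp at hc
      rw [if_pos rfl]
      have h2 : Runs 1 (atHead ⟨ok, A, true :: c⟩ (Ds.flatMap encStep).reverse φ.encode)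
          (.rewind ok, ⟨c.map Sum.inr, (Ds.flatMap encStep).reverse, φ.encode,
            (List.finRange n).map A, [], [], [], []⟩) := by
        rw [hφ]
        cases l <;> simp [isStepLetter] at hl
        all_goals exact .of_exec fun v => ⟨_, rfl⟩
      have h3 := runs_rewind (i := c.map Sum.inr) (t := φ.encode) (v := (List.finRange n).map A)
        (x := []) (w := []) (m := []) (o := []) (ok := ok) (Ds.flatMap encStep).reverse
      rw [List.reverse_reverse, List.length_reverse] at h3
      have h4 : Runs 1 (.load ok, ⟨c.map Sum.inr, [], Ds.flatMap encStep ++ φ.encode,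
          (List.finRange n).map A, [], [], [], []⟩)
          (atHead ⟨ok, A, c⟩ [] (Ds.flatMap encStep ++ φ.encode)) :=
        .of_exec fun v => ⟨_, rfl⟩
      have h5 := ih ⟨ok, A, c⟩ (by
        simp only [List.length_cons] at hlen ⊢
        omega)
      refine (((h1.trans h2 le_rfl).trans h3 le_rfl).trans h4 le_rfl).trans h5 ?_
      nlinarith

/-! ### The evaluation of the constraint -/

/-- The first `k` entries of the vector are moved to `aux`; the next one is remembered. -/
theorem runs_seek {mode lower : Bool} (k : ℕ) (v : List Bool) (hk : k < v.length) :
    Runs (2 * k + 2)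
      (.seek ok mode lower, ⟨i, d, encUnary k ++ t, v, x, w, m, o⟩)
      (.unseek ok mode lower v[k],
        ⟨i, d, t, v.drop k, ((v.take k).map fun b => (b, false)).reverse ++ x, w, m, o⟩) := by
  induction k generalizing v x with
  | zero =>
    cases v with
    | nil => simp at hk
    | cons b v =>
      have h : Runs 1 (.seek ok mode lower, ⟨i, d, encUnary 0 ++ t, b :: v, x, w, m, o⟩)
        (.unseek ok mode lower b, ⟨i, d, t, b :: v, x, w, m, o⟩) := .of_exec fun v => ⟨_, rfl⟩
      simpa using h.mono (t := 2) (by omega)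
  | succ k ih =>
    cases v with
    | nil => simp at hk
    | cons b v =>
      have h : Runs 1 (.seek ok mode lower, ⟨i, d, encUnary (k + 1) ++ t, b :: v, x, w, m, o⟩)
        (.seek ok mode lower, ⟨i, d, encUnary k ++ t, v, (b, false) :: x, w, m, o⟩) :=
        .of_exec fun v => ⟨_, rfl⟩
      have h' := h.trans (ih v (by simpa using hk)) (u := 2 * (k + 1) + 2) (by omega)
      simpa using h'

theorem runs_unseek {mode lower y : Bool} {v : List Bool} (l : List (Bool × Bool)) :
    Runs (l.length + 1)
      (.unseek ok mode lower y, ⟨i, d, t, v, l, w, m, o⟩)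
      (if lower then .bound ok mode y false else .formula (ok && (!mode || !y)),
        ⟨i, d, t, (l.map Prod.fst).reverse ++ v, [], w, m, o⟩) := by
  induction l generalizing v with
  | nil => exact .of_exec fun v => ⟨_, rfl⟩
  | cons p l ih =>
    have h : Runs 1 (.unseek ok mode lower y, ⟨i, d, t, v, p :: l, w, m, o⟩)
        (.unseek ok mode lower y, ⟨i, d, t, p.1 :: v, l, w, m, o⟩) := .of_exec fun v => ⟨_, rfl⟩
    simpa using h.trans ih (u := l.length + 1 + 1) (by omega)

theorem runs_atom {mode lower : Bool} (A : Fin n → Bool) (q : Fin n) :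
    Runs (3 * (encUnary q).length)
      (.seek ok mode lower, ⟨i, d, encUnary q ++ t, (List.finRange n).map A, [], w, m, o⟩)
      (if lower then .bound ok mode (A q) false else .formula (ok && (!mode || !A q)),
        ⟨i, d, t, (List.finRange n).map A, [], w, m, o⟩) := by
  have h1 := runs_seek (i := i) (d := d) (t := t) (x := []) (w := w) (m := m) (o := o) (ok := ok)
    (mode := mode) (lower := lower) q ((List.finRange n).map A) (by simp)
  have h2 := runs_unseek (i := i) (d := d) (t := t) (v := ((List.finRange n).map A).drop q)
    (w := w) (m := m) (o := o) (ok := ok) (mode := mode) (lower := lower)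
    (y := ((List.finRange n).map A)[(q : ℕ)]'(by simp))
    ((((List.finRange n).map A).take q).map fun b => (b, false)).reverse
  simp only [List.append_nil] at h1
  simp only [List.map_reverse, List.reverse_reverse, List.map_map, Function.comp_def,
    List.map_id', List.take_append_drop, List.length_reverse, List.length_map,
    List.length_take, List.length_finRange] at h2
  have h3 := h1.trans h2 (u := 3 * (encUnary q).length) (by
    simp only [encUnary, List.length_append, List.length_replicate, List.length_cons,
      List.length_nil]
    omega)
  simpa using h3

theorem runs_bound {mode y e : Bool} {v : List Bool} (bs : List Bool) :
    Runs (bs.length + 1)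
      (.bound ok mode y e, ⟨i, d, bs.map Letter.bit ++ Letter.comma :: t, v, x, w, m, o⟩)
      (.formula (ok && (!mode || !(e || decide (bs ≠ [])) || y)), ⟨i, d, t, v, x, w, m, o⟩) := by
  induction bs generalizing e with
  | nil =>
    have h : Runs 1 (.bound ok mode y e, ⟨i, d, Letter.comma :: t, v, x, w, m, o⟩)
        (.formula (ok && (!mode || !e || y)), ⟨i, d, t, v, x, w, m, o⟩) :=
      .of_exec fun v => ⟨_, rfl⟩
    simpa using h
  | cons b bs ih =>
    have h : Runs 1
        (.bound ok mode y e,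
          ⟨i, d, (b :: bs).map Letter.bit ++ Letter.comma :: t, v, x, w, m, o⟩)
        (.bound ok mode y true, ⟨i, d, bs.map Letter.bit ++ Letter.comma :: t, v, x, w, m, o⟩) :=
      .of_exec fun v => ⟨_, rfl⟩
    simpa using h.trans ih (u := bs.length + 1 + 1) (by omega)

/-- The formula on top of `todo` is read, in the mode on top of `modes`, both of which are removed. -/
theorem runs_check (A : Fin n → Bool) (φ : CardConstraint (Fin n)) (ok mode : Bool)
    (c : List Bool) (t : List Letter) (m : List Bool) :
    Runs (3 * φ.encode.length) (atFormula ok A c d (φ.encode ++ t) (mode :: m))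
      (atFormula (ok && (φ.check A mode c).1) A (φ.check A mode c).2 d t m) := by
  induction φ generalizing ok mode c t m with
  | geq q a =>
    have h1 : Runs 1 (atFormula ok A c d ((CardConstraint.geq q a).encode ++ t) (mode :: m))
        (.seek ok mode true, ⟨c.map Sum.inr, d, encUnary q ++ (encBinary a ++ t),
          (List.finRange n).map A, [], [], m, []⟩) := by
      rw [← List.append_assoc]
      exact .of_exec fun v => ⟨_, rfl⟩
    have h2 := h1.trans (runs_atom A q) le_rfl
    have h3 := runs_bound (i := c.map Sum.inr) (d := d) (t := t) (x := []) (w := []) (m := m)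
      (o := []) (ok := ok) (mode := mode) (y := A q) (e := false) (v := (List.finRange n).map A)
      (encodeNat a)
    have h4 := h2.trans (by simpa [encBinary] using h3)
      (u := 3 * (CardConstraint.geq q a).encode.length) (by
        simp only [CardConstraint.encode, encBinary, List.length_append, List.length_cons,
          List.length_map, List.length_nil]
        omega)
    simpa [encodeNat_eq_nil, CardConstraint.check, atFormula] using h4
  | eqZero q =>
    have h1 : Runs 1 (atFormula ok A c d ((CardConstraint.eqZero q).encode ++ t) (mode :: m))
        (.seek ok mode false, ⟨c.map Sum.inr, d, encUnary q ++ t,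
          (List.finRange n).map A, [], [], m, []⟩) := .of_exec fun v => ⟨_, rfl⟩
    exact h1.trans (runs_atom A q) (by simp only [CardConstraint.encode, List.length_cons]; omega)
  | and φ ψ ih1 ih2 =>
    have h1 : Runs 1 (atFormula ok A c d ((CardConstraint.and φ ψ).encode ++ t) (mode :: m))
        (atFormula ok A c d (φ.encode ++ (ψ.encode ++ t)) (mode :: mode :: m)) := by
      rw [← List.append_assoc]
      exact .of_exec fun v => ⟨_, rfl⟩
    have h2 := (h1.trans (ih1 ok mode c (ψ.encode ++ t) (mode :: m)) le_rfl).trans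
      (ih2 _ _ _ t m) (u := 3 * (CardConstraint.and φ ψ).encode.length) (by
        simp only [CardConstraint.encode, List.length_append, List.length_cons]; omega)
    simpa only [CardConstraint.check, Bool.and_assoc] using h2
  | or φ ψ ih1 ih2 =>
    have h1 : Runs 1 (atFormula ok A c d ((CardConstraint.or φ ψ).encode ++ t) (mode :: m))
        (atFormula ok A c.tail d (φ.encode ++ (ψ.encode ++ t))
          ((mode && c.headD false) :: (mode && !c.headD false) :: m)) := by
      rw [← List.append_assoc]
      cases c
      · exact .of_exec fun v => ⟨_, rfl⟩
      · exact .of_exec fun v => ⟨_, rfl⟩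
    have h2 := (h1.trans (ih1 ok _ c.tail (ψ.encode ++ t) _) le_rfl).trans
      (ih2 _ _ _ t m) (u := 3 * (CardConstraint.or φ ψ).encode.length) (by
        simp only [CardConstraint.encode, List.length_append, List.length_cons]; omega)
    simpa only [CardConstraint.check, Bool.and_assoc] using h2

end Loops

end Verifier

/-! ### The verifier runs in polynomial time -/

namespace Verifier

/-- The stacks are emptied, the outcome is written and the machine halts. -/
theorem evals_clean (ok : Bool) (v : Buffer) (k : ℕ) (i : List (Letter ⊕ Bool)) (d : List Letter)
    (l : List Bool) (hk : i.length + d.length + l.length ≤ k) :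
    Nonempty (StateTransition.EvalsToInTime machine.step
      (cfg (some (.clean ok), v, ⟨i, d, [], l, [], [], [], []⟩))
      (some (cfg (none, Buffer.empty, ⟨[], [], [], [], [], [], [], [ok]⟩))) (k + 1)) := by
  induction k generalizing v i d l with
  | zero =>
    obtain rfl : i = [] := List.eq_nil_of_length_eq_zero (by omega)
    obtain rfl : d = [] := List.eq_nil_of_length_eq_zero (by omega)
    obtain rfl : l = [] := List.eq_nil_of_length_eq_zero (by omega)
    exact ⟨⟨⟨1, step_cfg _ _ _⟩, le_rfl⟩⟩
  | succ k ih =>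
    by_cases hnil : i.length + d.length + l.length = 0
    · obtain ⟨e⟩ := ih v i d l (by omega)
      exact ⟨⟨e.toEvalsTo, e.steps_le_m.trans (by omega)⟩⟩
    · have h : Runs 1 (.clean ok, ⟨i, d, [], l, [], [], [], []⟩)
          (.clean ok, ⟨i.tail, d.tail, [], l.tail, [], [], [], []⟩) := by
        cases i <;> cases d <;> cases l
        · simp at hnil
        all_goals exact .of_exec fun v => ⟨_, rfl⟩
      obtain ⟨v', ⟨e₁⟩⟩ := h v
      obtain ⟨e₂⟩ := ih v' i.tail d.tail l.tail (by simp only [List.length_tail]; omega)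
      exact ⟨StateTransition.EvalsToInTime.trans _ _ _ _ _ _ e₁ e₂⟩

theorem initList_machine (w : List (Letter ⊕ Bool)) :
    initList machine w =
      cfg (some .readSize, Buffer.empty, ⟨w, [], [], [], [], [], [], []⟩) := by
  refine congrArg (TM2.Cfg.mk (Γ := Symbol) (Λ := Label) (σ := Buffer) (some .readSize)
    Buffer.empty) (funext fun k => ?_)
  cases k <;> rfl

theorem haltList_machine (b : Bool) :
    haltList machine [b] = cfg (none, Buffer.empty, ⟨[], [], [], [], [], [], [], [b]⟩) := by
  refine congrArg (TM2.Cfg.mk (Γ := Symbol) (Λ := Label) (σ := Buffer) none Buffer.empty)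
    (funext fun k => ?_)
  cases k <;> rfl

theorem runs_initialState (I : CRPInstance) (c : List Bool) :
    Runs (3 * (I.n + 1) +
        2 * ((I.minList.flatMap encStep ++ I.constraint.encode).length + 1))
      (.readSize, ⟨encodeWithCert CRPInstance.encode (I, c), [], [], [], [], [], [], []⟩)
      (atHead (I.initialState c) [] (I.minList.flatMap encStep ++ I.constraint.encode)) := by
  set z := I.minList.flatMap encStep ++ I.constraint.encode with hz
  set bs := (List.finRange I.n).map fun q => decide (q ∈ I.init) with hbs
  have hlen : bs.length = I.n := by simp [hbs]
  have hinput : encodeWithCert CRPInstance.encode (I, c) =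
      (encUnary I.n).map Sum.inl ++ (bs.map (fun b => Sum.inl (Letter.bit b)) ++
        (z.map Sum.inl ++ c.map Sum.inr)) := by
    simp [encodeWithCert, CRPInstance.encode, hbs, hz, Function.comp_def]
  have h1 := runs_readSize (i := bs.map (fun b => Sum.inl (Letter.bit b)) ++
    (z.map Sum.inl ++ c.map Sum.inr)) (d := []) (t := []) (v := []) (x := []) (w := []) (m := [])
    (o := []) I.n
  have h2 := runs_readInit (i := z.map Sum.inl ++ c.map Sum.inr) (d := []) (t := []) (v := [])
    (x := []) (m := []) (o := []) bs
  have h3 := runs_readRest (c := c) (d := []) (t := []) (v := []) (w := []) (m := [])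
    (x := (bs.map fun b => (b, b)).reverse) (o := []) z
  have h4 := runs_rewind (i := c.map Sum.inr) (t := []) (v := []) (w := []) (m := [])
    (x := (bs.map fun b => (b, b)).reverse) (o := []) (ok := true) z.reverse
  have h5 := runs_load (c := c) (d := []) (t := z) (v := []) (w := []) (m := []) (o := [])
    (ok := true) (bs.map fun b => (b, b)).reverse
  have hload : (withCert (fun (p : Bool × Bool) b => p.1 && b)
      (bs.map fun b => (b, b)).reverse c).reverse =
      (List.finRange I.n).map (I.initialState c).conf := by
    refine List.ext_getElem (by simp [length_withCert, hlen]) fun k h h' => ?_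
    have hk : k < I.n := by simpa using h'
    have hk' : I.n - 1 - (I.n - 1 - k) = k := by omega
    rw [List.getElem_reverse, getElem_withCert]
    simp [length_withCert, hbs, hk', CRPInstance.initialState]
  rw [hinput]
  rw [List.append_nil, ← hlen] at h1
  rw [List.append_nil] at h2 h3
  rw [List.append_nil, List.reverse_reverse, List.length_reverse] at h4
  rw [List.append_nil, hload] at h5
  simp only [List.length_reverse, List.length_map, hlen] at h1 h2 h5
  exact (((h1.trans h2 le_rfl).trans h3 le_rfl).trans h4 le_rfl).trans h5 (by omega)

theorem evals_machine (I : CRPInstance) (c : List Bool) (T : ℕ)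
    (hT : 4 * I.n + 3 * (I.minList.flatMap encStep).length +
      5 * I.constraint.encode.length + c.length + 7 +
      (c.length + 1) * ((I.minList.flatMap encStep).length * (4 * I.n + 5) + 3) ≤ T) :
    Nonempty (StateTransition.EvalsToInTime machine.step
      (initList machine (encodeWithCert CRPInstance.encode (I, c)))
      (some (haltList machine [CRPInstance.accepts (I, c)])) T) := by
  have h1 := runs_initialState I c
  have h2 := runs_passes I.minList I.constraint (c.length + 1) (I.initialState c) (by
    simp only [CRPInstance.initialState, List.length_drop]
    omega)
  have hlen := VerifierState.length_cert_passes_le I.minList (c.length + 1) (I.initialState c)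
  have hlen₀ : (I.initialState c).cert.length ≤ c.length := by simp [CRPInstance.initialState]
  change Runs _ _ (atFormula (I.finalState c).ok (I.finalState c).conf (I.finalState c).cert _ _ _)
    at h2
  have hlen' := CardConstraint.length_check_le (I.finalState c).conf I.constraint true
    (I.finalState c).cert
  replace hlen' := (hlen'.trans hlen).trans hlen₀
  have h3 := runs_check (d := (I.minList.flatMap encStep).reverse) (I.finalState c).conf
    I.constraint (I.finalState c).ok true (I.finalState c).cert [] []
  rw [List.append_nil] at h3
  change Runs _ _ (atFormula (CRPInstance.accepts (I, c)) _ _ _ _ _) at h3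
  generalize CRPInstance.accepts (I, c) = b at *
  generalize (I.constraint.check (I.finalState c).conf true (I.finalState c).cert).2 = c' at *
  generalize (I.finalState c).conf = A at *
  have h4 : Runs 1 (atFormula b A c' (I.minList.flatMap encStep).reverse [] [])
      (.clean b, ⟨c'.map Sum.inr, (I.minList.flatMap encStep).reverse, [],
        (List.finRange I.n).map A, [], [], [], []⟩) := .of_exec fun v => ⟨_, rfl⟩
  obtain ⟨v, ⟨e₁⟩⟩ := (((h1.trans h2 le_rfl).trans h3 le_rfl).trans h4 le_rfl) Buffer.empty
  obtain ⟨e₂⟩ := evals_clean b v _ (c'.map Sum.inr) (I.minList.flatMap encStep).reverse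
    ((List.finRange I.n).map A) le_rfl
  rw [initList_machine, haltList_machine]
  have e := StateTransition.EvalsToInTime.trans _ _ _ _ _ _ e₁ e₂
  refine ⟨⟨e.toEvalsTo, e.steps_le_m.trans (le_trans ?_ hT)⟩⟩
  simp only [List.length_append, List.length_map, List.length_reverse, List.length_finRange]
  omega

theorem length_encodeWithCert (I : CRPInstance) (c : List Bool) :
    (encodeWithCert CRPInstance.encode (I, c)).length = I.encode.length + c.length := by
  simp [encodeWithCert]

theorem length_encode (I : CRPInstance) :
    I.encode.length = 2 * I.n + 1 + (I.minList.flatMap encStep).length +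
      I.constraint.encode.length := by
  simp only [CRPInstance.encode, encUnary, List.length_append, List.length_replicate,
    List.length_cons, List.length_nil, List.length_map, List.length_finRange]
  omega

theorem nonempty_polyTime :
    Nonempty (TM2ComputableInPolyTime (encodeWithCert CRPInstance.encode) encodeBool
      CRPInstance.accepts) := by
  refine ⟨{
    tm := machine
    inputAlphabet := Equiv.refl _
    outputAlphabet := Equiv.refl _
    time := 5 * .X + 7 + (.X + 1) * (.X * (4 * .X + 5) + 3)
    outputsFun := fun x => ?_ }⟩
  refine Classical.choice ?_
  obtain ⟨I, c⟩ := x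
  have h := evals_machine I c (5 * (encodeWithCert CRPInstance.encode (I, c)).length + 7 +
    ((encodeWithCert CRPInstance.encode (I, c)).length + 1) *
      ((encodeWithCert CRPInstance.encode (I, c)).length *
        (4 * (encodeWithCert CRPInstance.encode (I, c)).length + 5) + 3)) (by
      rw [length_encodeWithCert, length_encode]
      set a := (I.minList.flatMap encStep).length
      set b := I.constraint.encode.length
      have : (c.length + 1) * (a * (4 * I.n + 5) + 3) ≤
          (2 * I.n + 1 + a + b + c.length + 1) *
            ((2 * I.n + 1 + a + b + c.length) *
              (4 * (2 * I.n + 1 + a + b + c.length) + 5) + 3) := by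
        gcongr <;> omega
      omega)
  have hmap : (encodeWithCert CRPInstance.encode (I, c)).map
      (Equiv.refl (Letter ⊕ Bool)).invFun = encodeWithCert CRPInstance.encode (I, c) :=
    List.map_id _
  simp only [TM2OutputsInTime, Polynomial.eval_add, Polynomial.eval_mul, Polynomial.eval_X,
    Polynomial.eval_ofNat, Polynomial.eval_one]
  exact (congrArg (fun w => Nonempty (StateTransition.EvalsToInTime machine.step
    (initList machine w) (some (haltList machine [CRPInstance.accepts (I, c)])) _)) hmap).mpr h

end Verifier

/-- The cardinality reachability problem is in NP. -/
theorem CRPInstance.inNP : InNP CRPInstance.encode CRPInstance.Holds := by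
  refine ⟨.X + (2 * .X + 1) * (.X * (.X + 1) + 1) + .X, accepts, Verifier.nonempty_polyTime,
    fun I => ⟨fun h => ?_, fun ⟨c, _, hc⟩ => holds_of_accepts hc⟩⟩
  obtain ⟨c, hc, hacc⟩ := exists_accepts h
  refine ⟨c, hc.trans ?_, hacc⟩
  have hlen := Verifier.length_encode I
  have hL : I.minList.length ≤ (I.minList.flatMap encStep).length :=
    Verifier.length_le_length_flatMap _ _ fun D => by simp [encStep]
  simp only [Polynomial.eval_add, Polynomial.eval_mul, Polynomial.eval_X, Polynomial.eval_one,
    Polynomial.eval_ofNat]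
  gcongr <;> omega

theorem mainTheorem10 :
    InNP CRPInstance.encode CRPInstance.Holds ∧
    ∀ (Q : Type*) [Fintype Q] (S : TransitionCS Q), S.toCounterSystem.Compatible →
      ∀ Q₀ : Set Q,
        (∀ x y : AbsConfig Unit Q, AbsConfig.IsInitial () Q₀ x →
          Relation.ReflTransGen S.toCounterSystem.AbsStep x y →
          ∃ (n m : ℕ) (ρ : ℕ → AbsConfig Unit Q),
            IsUpDownPath S.toCounterSystem.AbsStep AbsConfig.supp n m ρ ∧
            n + m ≤ 2 * Fintype.card Q ∧ ρ 0 = x ∧ ρ (n + m) = y) ∧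
        ∀ φ : CardConstraint Q,
          (S.toCounterSystem.CRP () Q₀ φ ↔
            ∃ (n m : ℕ) (ρ : ℕ → AbsConfig Unit Q),
              IsUpDownPath S.toCounterSystem.AbsStep AbsConfig.supp n m ρ ∧
              n + m ≤ 2 * Fintype.card Q ∧ AbsConfig.IsInitial () Q₀ (ρ 0) ∧
              φ.abs.AbsSat (ρ (n + m)).2) ∧
          (S.toCounterSystem.CRP () Q₀ φ →
            ∃ (n m : ℕ) (ρ : ℕ → Config Unit Q),
              IsUpDownPath S.toCounterSystem.Step Config.supp n m ρ ∧
              n + m ≤ 2 * Fintype.card Q ∧ Config.IsInitial () Q₀ (ρ 0) ∧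
              φ.Sat (ρ (n + m)).2) := by
  refine ⟨CRPInstance.inNP, fun Q _ S hS Q₀ => ⟨fun x y _ hxy => S.exists_normalized_path hxy,
    S.normalized_runs hS Q₀⟩⟩
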